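/- Throughout, $M^n$ is a connected smooth $n$-manifold, submanifolds are smooth immersions $f:M^n\to\mathbb R^N$, and $M$ carries the metric induced by the immersion considered, with second fundamental form $\alpha$, normal connection $\nabla^\perp$ and shape operators $A$. **Ribaucour transforms.** Let $\varphi_1,\dots,\varphi_r\in C^\infty(M)$ and let $\beta_1,\dots,\beta_r$ be smooth normal fields of $f$ with $\alpha(X,\nabla\varphi_i)+\nabla^\perp_X\beta_i=0$. Put $\mathcal F_i=f_*\nabla\varphi_i+\beta_i$; the Codazzi tensor of $(\varphi_i,\beta_i)$ is $\Phi_iX=\nabla_X\nabla\varphi_i-A_{\beta_i}X$. If $\Omega=(\Omega_{ij})$ is a smooth $r\times r$ matrix function that is invertible everywhere, with $d\Omega_{ij}=\langle\mathcal F_i,d\mathcal F_j\rangle$ and $\Omega_{ij}+\Omega_{ji}=\langle\mathcal F_i,\mathcal F_j\rangle$, and if $\tilde f=f-\sum_i(\Omega^{-1}\varphi)_i\mathcal F_i$ is an immersion, then $\tilde f=\mathcal R_{\varphi,\beta,\Omega}(f)$ is a vectorial Ribaucour transform of $f$. For $r=1$ one has $\Omega=\frac12|\mathcal F|^2$ and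 $\tilde f$ is called a Ribaucour transform of $f$ determined by $(\varphi,\beta)$. **Bianchi quadrilaterals.** $\{f_{12},f_1,f_2,f\}$ is a Bianchi quadrilateral if in the cycle $f,f_1,f_{12},f_2$ any two neighbours are Ribaucour transforms of each other, the two Codazzi tensors at each vertex commute, and $f_{12}=\mathcal R_{\varphi,\beta,\Omega}(f)$ for some $2\times 2$ matrix function $\Omega$, where $\varphi=(\varphi_1,\varphi_2)$, $\beta=(\beta_1,\beta_2)$ and $(\varphi_i,\beta_i)$ determines $f_i$. **Bianchi cubes.** For $k\ge2$, a Bianchi $k$-cube is a tuple $(\mathcal C_0,\dots,\mathcal C_k)$, where $\mathcal C_r$ is a set of exactly $\binom kr$ submanifolds, whose elements can be labelled as $\mathcal C_r=\{f_\alpha:\alpha\subset\{1,\dots,k\},|\alpha|=r\}$ such that each $f_{\{i\}}$ is a Ribaucour transform of $f_\emptyset$ and, whenever $|\alpha|\ge2$ and $i\ne j$ are in $\alpha$, $f_\alpha$ is a Ribaucour transform of $f_{\alpha\setminus\{i\}}$ and $\{f_{\alpha\setminus\{i,j\}},f_{\alpha\setminus\{i\}},f_{\alpha\setminus\{j\}},f_\alpha\}$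 is a Bianchi quadrilateral; the labelling is required to be unique up to a permutation of $\{1,\dots,k\}$ (so the elements of $\mathcal C_s$ below a given element of $\mathcal C_{s+1}$, and the element of $\mathcal C_{s-1}$ below two of them, are uniquely determined). **Theorem (Bianchi $k$-cube theorem).** Let $k\ge2$, let $f:M^n\to\mathbb R^N$ be an immersion, and let $f_1,\dots,f_k$ be Ribaucour transforms of $f$ determined by $(\varphi_1,\beta_1),\dots,(\varphi_k,\beta_k)$ that are independent: the image of $(\varphi_1,\dots,\varphi_k):M\to\mathbb R^k$ spans $\mathbb R^k$, and $\mathcal F_1(x),\dots,\mathcal F_k(x)$ are linearly independent for every $x\in M$. For $i\ne j$ let $f_{ij}=f_{ji}$ be such that $\{f_{ij},f_i,f_j,f\}$ is a Bianchi quadrilateral, and assume that this choice is generic in the following sense: if $\Omega$ is the $k\times k$ matrix function with $d\Omega_{ij}=\langle\mathcal F_i,d\mathcal F_j\rangle$, $\Omega_{ij}+\Omega_{ji}=\langle\mathcal F_i,\mathcal F_j\rangle$ and such that each $f_{ij}$ is the vectorial Ribaucour transform of $f$ determined by $(\varphi_i,\varphi_j)$, $(\beta_i,\beta_j)$ and the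 principal submatrix $\Omega_{\{i,j\}}$, then for every $\alpha\subset\{1,\dots,k\}$ the principal minor $\det\Omega_\alpha$ vanishes nowhere and the map $f-\sum_{i\in\alpha}(\Omega_\alpha^{-1}\varphi_\alpha)_i\mathcal F_i$, with $\varphi_\alpha=(\varphi_i)_{i\in\alpha}$, is an immersion. Then there exists a unique Bianchi $k$-cube $(\mathcal C_0,\dots,\mathcal C_k)$ with $\mathcal C_0=\{f\}$, $\mathcal C_1=\{f_1,\dots,f_k\}$ and $\mathcal C_2=\{f_{ij}\}_{i\ne j}$. -/

import Mathlib

open scoped Manifold ContDiff Matrix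

/-- Euclidean space `ℝ^N`. -/
abbrev Eucl (N : ℕ) : Type := EuclideanSpace ℝ (Fin N)

namespace Ribaucour

section Calculus

variable (n : ℕ) {N : ℕ} {M : Type*} [TopologicalSpace M] [ChartedSpace (Eucl n) M]

/-- The differential at `x` of a map from the `n`-manifold `M` to a normed space. -/
noncomputable def diff {G : Type*} [NormedAddCommGroup G] [NormedSpace ℝ G]
    (g : M → G) (x : M) : TangentSpace (𝓡 n) x →L[ℝ] G :=
  mfderiv (𝓡 n) 𝓘(ℝ, G) g x

/-- Smooth immersions `f : M^n → ℝ^N`. The manifold `M` always carries the metric induced by the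
immersion under consideration, so that `f` is an isometric immersion. -/
def IsSmoothImmersion (f : M → Eucl N) : Prop :=
  ContMDiff (𝓡 n) 𝓘(ℝ, Eucl N) ∞ f ∧ ∀ x, Function.Injective (diff n f x)

/-- The tangent space `f_* T_x M`, as a subspace of `ℝ^N`. -/
noncomputable def tangentPlane (f : M → Eucl N) (x : M) : Submodule ℝ (Eucl N) :=
  LinearMap.range (diff n f x).toLinearMap

/-- The tangential component of a vector of `ℝ^N` at `f x`. -/
noncomputable def tangentPart (f : M → Eucl N) (x : M) : Eucl N →L[ℝ] Eucl N :=
  (tangentPlane n f x).starProjection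

/-- The normal component of a vector of `ℝ^N` at `f x`. -/
noncomputable def normalPart (f : M → Eucl N) (x : M) : Eucl N →L[ℝ] Eucl N :=
  (tangentPlane n f x)ᗮ.starProjection

/-- The vector field `f_* Z` along `f`. -/
noncomputable def push (f : M → Eucl N) (Z : ∀ x : M, TangentSpace (𝓡 n) x) (x : M) : Eucl N :=
  diff n f x (Z x)

/-- The second fundamental form `α(X, Z)`: the normal component of the derivative of `f_* Z` in
the direction `X` (Gauss formula). -/
noncomputable def secondFundamentalForm (f : M → Eucl N) (x : M) (X : TangentSpace (𝓡 n) x)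
    (Z : ∀ x : M, TangentSpace (𝓡 n) x) : Eucl N :=
  normalPart n f x (diff n (push n f Z) x X)

/-- `f_* ∇_X Z` for the Levi-Civita connection `∇` of the induced metric (Gauss formula). -/
noncomputable def pushLeviCivita (f : M → Eucl N) (x : M) (X : TangentSpace (𝓡 n) x)
    (Z : ∀ x : M, TangentSpace (𝓡 n) x) : Eucl N :=
  tangentPart n f x (diff n (push n f Z) x X)

/-- The normal derivative `∇^⊥_X β` of a normal field `β` (Weingarten formula). -/
noncomputable def normalDeriv (f : M → Eucl N) (x : M) (X : TangentSpace (𝓡 n) x)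
    (β : M → Eucl N) : Eucl N :=
  normalPart n f x (diff n β x X)

/-- `f_* A_β X` for the shape operator `A_β` of a normal field `β` (Weingarten formula). -/
noncomputable def pushShape (f : M → Eucl N) (x : M) (X : TangentSpace (𝓡 n) x)
    (β : M → Eucl N) : Eucl N :=
  - tangentPart n f x (diff n β x X)

end Calculus

/-- Data `(φ, β)` of a scalar Ribaucour transformation of `f`: a smooth function `φ` and a smooth
normal field `β` with `α(X, ∇φ) + ∇^⊥_X β = 0`. The fields `grad` and `Φ` only name the gradient of
`φ` in the induced metric and the associated Codazzi tensor `Φ X = ∇_X ∇φ - A_β X`; for an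
immersion `f` they exist and are uniquely determined by `φ` and `β`. -/
structure Datum (n : ℕ) {N : ℕ} {M : Type*} [TopologicalSpace M] [ChartedSpace (Eucl n) M]
    (f : M → Eucl N) where
  φ : M → ℝ
  β : M → Eucl N
  smooth_φ : ContMDiff (𝓡 n) 𝓘(ℝ, ℝ) ∞ φ
  smooth_β : ContMDiff (𝓡 n) 𝓘(ℝ, Eucl N) ∞ β
  normal_β : ∀ x, β x ∈ (tangentPlane n f x)ᗮ
  grad : ∀ x : M, TangentSpace (𝓡 n) x
  smooth_grad : ContMDiff (𝓡 n) 𝓘(ℝ, Eucl N) ∞ (push n f grad)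
  grad_spec : ∀ (x : M) (X : TangentSpace (𝓡 n) x),
    inner ℝ (push n f grad x) (diff n f x X) = diff n φ x X
  normal_eq : ∀ (x : M) (X : TangentSpace (𝓡 n) x),
    secondFundamentalForm n f x X grad + normalDeriv n f x X β = 0
  Φ : ∀ x : M, TangentSpace (𝓡 n) x →L[ℝ] TangentSpace (𝓡 n) x
  Φ_spec : ∀ (x : M) (X : TangentSpace (𝓡 n) x),
    diff n f x (Φ x X) = pushLeviCivita n f x X grad - pushShape n f x X β

section Transforms

variable {n N : ℕ} {M : Type*} [TopologicalSpace M] [ChartedSpace (Eucl n) M]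

/-- The field `F = f_* ∇φ + β` along `f`. -/
noncomputable def Datum.F {f : M → Eucl N} (d : Datum n f) (x : M) : Eucl N :=
  push n f d.grad x + d.β x

/-- `g` is the scalar Ribaucour transform `f - Ω⁻¹ φ F`, `Ω = ½⟨F, F⟩`, of `f` determined
by `d`. -/
def Datum.Determines {f : M → Eucl N} (d : Datum n f) (g : M → Eucl N) : Prop :=
  IsSmoothImmersion n f ∧ IsSmoothImmersion n g ∧ (∀ x, d.F x ≠ 0) ∧
    ∀ x, g x = f x - (((1 / 2 : ℝ) * inner ℝ (d.F x) (d.F x))⁻¹ * d.φ x) • d.F x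

/-- `g` is a (scalar) Ribaucour transform of `f`. -/
def IsRibaucourTransform (n : ℕ) {N : ℕ} {M : Type*} [TopologicalSpace M]
    [ChartedSpace (Eucl n) M] (f g : M → Eucl N) : Prop :=
  ∃ d : Datum n f, d.Determines g

variable {ι : Type*} [Fintype ι] [DecidableEq ι]

/-- The conditions on the matrix function `Ω` in the vectorial Ribaucour transformation with
`V = ℝ^ι` and components `d i` of the data: `dΩ = Fᵗ dF` and `Ω + Ωᵗ = Fᵗ F`. -/
def IsOmega {f : M → Eucl N} (d : ι → Datum n f) (Ω : M → Matrix ι ι ℝ) : Prop :=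
  ∀ i j, ContMDiff (𝓡 n) 𝓘(ℝ, ℝ) ∞ (fun x => Ω x i j) ∧
    (∀ (x : M) (X : TangentSpace (𝓡 n) x),
      diff n (fun y => Ω y i j) x X = inner ℝ ((d i).F x) (diff n (d j).F x X)) ∧
    ∀ x, Ω x i j + Ω x j i = inner ℝ ((d i).F x) ((d j).F x)

/-- The map `f - F Ω⁻¹ φ`. -/
noncomputable def vectorialMap {f : M → Eucl N} (d : ι → Datum n f) (Ω : M → Matrix ι ι ℝ)
    (x : M) : Eucl N :=
  f x - ∑ i, ((Ω x)⁻¹ *ᵥ fun j => (d j).φ x) i • (d i).F x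

/-- `g` is the vectorial Ribaucour transform of `f` determined by the data `d` and `Ω`. -/
def IsVectorialTransform {f : M → Eucl N} (d : ι → Datum n f) (Ω : M → Matrix ι ι ℝ)
    (g : M → Eucl N) : Prop :=
  IsSmoothImmersion n f ∧ IsOmega d Ω ∧ (∀ x, (Ω x).det ≠ 0) ∧ IsSmoothImmersion n g ∧
    ∀ x, g x = vectorialMap d Ω x

/-- The Codazzi tensors of two data commute. -/
def CodazziCommute {f : M → Eucl N} (d e : Datum n f) : Prop :=
  ∀ x, (d.Φ x).comp (e.Φ x) = (e.Φ x).comp (d.Φ x)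

/-- `{f₁₂, f₁, f₂, f}` is a Bianchi quadrilateral, with `f₁₂` opposite to `f`: any two neighbours
in the cycle `f, f₁, f₁₂, f₂` are Ribaucour transforms of each other, the two Codazzi tensors at
each of the four vertices commute, and the four transformations close up, i.e. `f₁₂` is the
vectorial Ribaucour transform of `f` (with `V = ℝ²`) whose components are the data of
`f → f₁` and `f → f₂`. -/
def IsBianchiQuadrilateral (n : ℕ) {N : ℕ} {M : Type*} [TopologicalSpace M]
    [ChartedSpace (Eucl n) M] (f f₁ f₂ f₁₂ : M → Eucl N) : Prop :=
  ∃ (a₁ a₂ : Datum n f) (b b₁₂ : Datum n f₁) (c c₁₂ : Datum n f₂) (e₁ e₂ : Datum n f₁₂),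
    a₁.Determines f₁ ∧ a₂.Determines f₂ ∧
    b.Determines f ∧ b₁₂.Determines f₁₂ ∧
    c.Determines f ∧ c₁₂.Determines f₁₂ ∧
    e₁.Determines f₁ ∧ e₂.Determines f₂ ∧
    CodazziCommute a₁ a₂ ∧ CodazziCommute b b₁₂ ∧ CodazziCommute c c₁₂ ∧ CodazziCommute e₁ e₂ ∧
    ∃ Ω : M → Matrix (Fin 2) (Fin 2) ℝ, IsVectorialTransform ![a₁, a₂] Ω f₁₂

end Transforms

section Cubes

variable {n N k : ℕ} {M : Type*} [TopologicalSpace M] [ChartedSpace (Eucl n) M]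

/-- The data of `k` Ribaucour transforms are independent: the image of
`φ = (φ_1, …, φ_k) : M → ℝ^k` spans `ℝ^k`, and the bundle map `F : ℝ^k → f^* Tℝ^N` is injective. -/
def Independent {f : M → Eucl N} (d : Fin k → Datum n f) : Prop :=
  Submodule.span ℝ (Set.range fun (x : M) (i : Fin k) => (d i).φ x) = ⊤ ∧
    ∀ x, LinearIndependent ℝ fun i => (d i).F x

/-- The data indexed by `α ⊆ {1, …, k}`. -/
def subData {f : M → Eucl N} (d : Fin k → Datum n f) (α : Finset (Fin k)) : α → Datum n f :=
  fun i => d i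

/-- The principal submatrix `Ω_α`. -/
def subOmega (Ω : M → Matrix (Fin k) (Fin k) ℝ) (α : Finset (Fin k)) (x : M) : Matrix α α ℝ :=
  (Ω x).submatrix Subtype.val Subtype.val

/-- The matrix `Ω` encodes the choice `f_{ij} = g i j`: it satisfies `dΩ = Fᵗ dF` and
`Ω + Ωᵗ = Fᵗ F`, and `f_{ij}` is the vectorial Ribaucour transform of `f` with matrix
`Ω_{ {i, j} }`. -/
def Encodes {f : M → Eucl N} (d : Fin k → Datum n f) (g : Fin k → Fin k → M → Eucl N)
    (Ω : M → Matrix (Fin k) (Fin k) ℝ) : Prop :=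
  IsOmega d Ω ∧
    ∀ i j, i ≠ j → IsVectorialTransform (subData d {i, j}) (subOmega Ω {i, j}) (g i j)

/-- The choice of the `f_{ij}` is generic: for the matrix `Ω` that encodes it, no principal minor
vanishes and the vectorial Ribaucour transforms of `f` determined by the `Ω_α` are defined,
that is, are immersions. -/
def IsGeneric {f : M → Eucl N} (d : Fin k → Datum n f) (g : Fin k → Fin k → M → Eucl N) : Prop :=
  ∀ Ω : M → Matrix (Fin k) (Fin k) ℝ, Encodes d g Ω → ∀ α : Finset (Fin k),
    (∀ x, (subOmega Ω α x).det ≠ 0) ∧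
      IsSmoothImmersion n (vectorialMap (subData d α) (subOmega Ω α))

/-- `c` places the elements of the families `C 0, …, C k` at the vertices of a `k`-dimensional
combinatorial cube, those of `C r` at the subsets with `r` elements, so that the elements of `C 1`
are Ribaucour transforms of the element of `C 0`, and so that for `2 ≤ |α|`, `i ≠ j` in `α`, the
submanifold `c α` is a Ribaucour transform of `c (α \ {i})`, and `c (α \ {i, j})`, `c (α \ {i})`,
`c (α \ {j})`, `c α` form a Bianchi quadrilateral. -/
structure IsCubeLabelling (n : ℕ) {N k : ℕ} {M : Type*} [TopologicalSpace M]
    [ChartedSpace (Eucl n) M] (C : Fin (k + 1) → Set (M → Eucl N))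
    (c : Finset (Fin k) → M → Eucl N) : Prop where
  image : ∀ r : Fin (k + 1), C r = c '' {α | α.card = r}
  bottom : ∀ i, IsRibaucourTransform n (c ∅) (c {i})
  edge : ∀ α : Finset (Fin k), 2 ≤ α.card → ∀ i ∈ α, IsRibaucourTransform n (c (α.erase i)) (c α)
  face : ∀ α : Finset (Fin k), 2 ≤ α.card → ∀ i ∈ α, ∀ j ∈ α, i ≠ j →
    IsBianchiQuadrilateral n (c ((α.erase i).erase j)) (c (α.erase i)) (c (α.erase j)) (c α)

/-- Bianchi `k`-cubes: `C r` has exactly `k.choose r` elements, the families are the vertices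
of a cube as above, and the cube structure is unique up to renaming the directions `1, …, k`
(so the `s + 1` elements of `C s` below a given element of `C (s + 1)`, and the element
of `C (s - 1)` below any two of these, are uniquely determined). -/
def IsBianchiCube (n : ℕ) {N k : ℕ} {M : Type*} [TopologicalSpace M]
    [ChartedSpace (Eucl n) M] (C : Fin (k + 1) → Set (M → Eucl N)) : Prop :=
  (∀ r : Fin (k + 1), (C r).ncard = k.choose r) ∧
    ∃ c : Finset (Fin k) → M → Eucl N, IsCubeLabelling n C c ∧
      ∀ c' : Finset (Fin k) → M → Eucl N, IsCubeLabelling n C c' →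
        ∃ σ : Equiv.Perm (Fin k), ∀ α, c' α = c (α.image σ)

end Cubes

end Ribaucour

open scoped Manifold ContDiff Matrix

/-!
The Bianchi cube is written down explicitly. The quadrilaterals prescribe `2 × 2` matrix functions
that fit together to one `k × k` matrix function `Ω` (`encodes_assemble`), and the vertex with index
`γ ⊆ {1, …, k}` is the vectorial Ribaucour transform `f - F_γ Ω_γ⁻¹ φ_γ` (`vertex`).

A datum `(φ, β)` is the same as a pair `(φ, F)` with `⟨F, df⟩ = dφ` and `dF` tangent to `f`
(`Datum.inner_F`, `Datum.diff_F`, `exists_datum`). At the vertex `γ` the Schur complements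
`φ_i - Ω_{iγ} Ω_γ⁻¹ φ_γ` and `F_i - F_γ Ω_γ⁻¹ Ω_{γi}` are again data, with the Schur complement of
`Ω_γ` as their matrix (`exists_vertexDatum`, `isOmega_schur`): all differentials involved are
images of vectors tangent to `f` under one orthogonal transformation, the reflection
`I - F_γ Ω_γ⁻¹ F_γᵗ`. Back substitution shows that a transform of the vertex `γ` by means of these
data is another vertex, so that all faces of the cube are vectorial transforms. The Codazzi tensors
of the new data, and of their inverses, lie in the bicommutant of those of the given data, hence
they commute.

For the uniqueness, the datum of a scalar transform is unique up to a constant factor, provided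
that its function is not identically zero (`Datum.proportional`). By independence this holds for all
the edges of the cube (`exists_vertexφ_ne_zero`). Hence the fourth vertex `h` of any quadrilateral
over the edges from `α \ {i, j}` to `α \ {j}` and `α \ {i}` is `f - F w`, where `w` solves the linear
system of the vertex `α` up to an antisymmetric perturbation in the rows `i` and `j`
(`GenericSystem.exists_of_quadrilateral`). If `α` has at least three elements, the quadrilaterals
over different pairs `i, j` leave no row perturbed, and `h` is the vertex `α`. If `α` has two
elements, `h` belongs to the given second level, and its expansion in the `F_i` tells which of the
elements it is. This determines every labelling of every cube with the given lower levels, up to a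
permutation of the directions.
-/

/-! ### Differential calculus on the manifold -/

namespace Ribaucour

section DifferentialCalculus

open Filter Topology

variable {n : ℕ} {M : Type*} [TopologicalSpace M] [ChartedSpace (Eucl n) M]
  {G : Type*} [NormedAddCommGroup G] [NormedSpace ℝ G]
  {H : Type*} [NormedAddCommGroup H] [InnerProductSpace ℝ H]

theorem hasMFDerivAt_diff {g : M → G} (hg : ContMDiff (𝓡 n) 𝓘(ℝ, G) ∞ g) (x : M) :
    HasMFDerivAt (𝓡 n) 𝓘(ℝ, G) g x (diff n g x) :=
  ((hg x).mdifferentiableAt (by simp)).hasMFDerivAt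

/-- The differential at `x`, read in the preferred chart at `x` as a linear map on the model
space. -/
noncomputable def chartDiff (n : ℕ) {M : Type*} [TopologicalSpace M] [ChartedSpace (Eucl n) M]
    {G : Type*} [NormedAddCommGroup G] [NormedSpace ℝ G] (g : M → G) (x : M) : Eucl n →L[ℝ] G :=
  fderiv ℝ (g ∘ (extChartAt (𝓡 n) x).symm) (extChartAt (𝓡 n) x x)

/-- The differential at `x` is a derivative on the model space in the preferred chart at `x`; this
reduces the rules below to those of calculus on the model space. -/
theorem hasFDerivAt_chart_diff {g : M → G} (hg : ContMDiff (𝓡 n) 𝓘(ℝ, G) ∞ g) (x : M) :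
    HasFDerivAt (g ∘ (extChartAt (𝓡 n) x).symm) (show Eucl n →L[ℝ] G from diff n g x)
      (extChartAt (𝓡 n) x x) := by
  have h : HasFDerivWithinAt (g ∘ (extChartAt (𝓡 n) x).symm)
      (show Eucl n →L[ℝ] G from diff n g x) (Set.range (𝓡 n)) (extChartAt (𝓡 n) x x) :=
    (hasMFDerivAt_diff hg x).2
  rwa [ModelWithCorners.range_eq_univ, hasFDerivWithinAt_univ] at h

theorem hasFDerivAt_chart {g : M → G} (hg : ContMDiff (𝓡 n) 𝓘(ℝ, G) ∞ g) (x : M) :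
    HasFDerivAt (g ∘ (extChartAt (𝓡 n) x).symm) (chartDiff n g x) (extChartAt (𝓡 n) x x) :=
  (hasFDerivAt_chart_diff hg x).differentiableAt.hasFDerivAt

theorem diff_eq_chartDiff {g : M → G} (hg : ContMDiff (𝓡 n) 𝓘(ℝ, G) ∞ g) (x : M)
    (X : TangentSpace (𝓡 n) x) : diff n g x X = chartDiff n g x X :=
  congrArg (fun L : Eucl n →L[ℝ] G => L X)
    ((hasFDerivAt_chart_diff hg x).unique (hasFDerivAt_chart hg x))

theorem comp_chart_apply {G : Type*} (g : M → G) (x : M) :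
    (g ∘ (extChartAt (𝓡 n) x).symm) (extChartAt (𝓡 n) x x) = g x := by
  simp

theorem diff_sub {g h : M → G} (hg : ContMDiff (𝓡 n) 𝓘(ℝ, G) ∞ g)
    (hh : ContMDiff (𝓡 n) 𝓘(ℝ, G) ∞ h) (x : M) (X : TangentSpace (𝓡 n) x) :
    diff n (fun y => g y - h y) x X = diff n g x X - diff n h x X := by
  have H := (hasFDerivAt_chart hg x).sub (hasFDerivAt_chart hh x)
  have hs : ContMDiff (𝓡 n) 𝓘(ℝ, G) ∞ fun y => g y - h y := hg.sub hh
  rw [diff_eq_chartDiff hs, diff_eq_chartDiff hg, diff_eq_chartDiff hh,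
    (hasFDerivAt_chart hs x).unique H]
  rfl

theorem diff_add {g h : M → G} (hg : ContMDiff (𝓡 n) 𝓘(ℝ, G) ∞ g)
    (hh : ContMDiff (𝓡 n) 𝓘(ℝ, G) ∞ h) (x : M) (X : TangentSpace (𝓡 n) x) :
    diff n (fun y => g y + h y) x X = diff n g x X + diff n h x X := by
  have H := (hasFDerivAt_chart hg x).add (hasFDerivAt_chart hh x)
  have hs : ContMDiff (𝓡 n) 𝓘(ℝ, G) ∞ fun y => g y + h y := hg.add hh
  rw [diff_eq_chartDiff hs, diff_eq_chartDiff hg, diff_eq_chartDiff hh,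
    (hasFDerivAt_chart hs x).unique H]
  rfl

theorem diff_smul {u : M → ℝ} {g : M → G} (hu : ContMDiff (𝓡 n) 𝓘(ℝ, ℝ) ∞ u)
    (hg : ContMDiff (𝓡 n) 𝓘(ℝ, G) ∞ g) (x : M) (X : TangentSpace (𝓡 n) x) :
    diff n (fun y => u y • g y) x X = u x • diff n g x X + diff n u x X • g x := by
  have H := (hasFDerivAt_chart hu x).smul (hasFDerivAt_chart hg x)
  have hs : ContMDiff (𝓡 n) 𝓘(ℝ, G) ∞ fun y => u y • g y := hu.smul hg
  rw [diff_eq_chartDiff hs, diff_eq_chartDiff hu, diff_eq_chartDiff hg,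
    (hasFDerivAt_chart hs x).unique H, comp_chart_apply, comp_chart_apply]
  rfl

theorem diff_mul {u v : M → ℝ} (hu : ContMDiff (𝓡 n) 𝓘(ℝ, ℝ) ∞ u)
    (hv : ContMDiff (𝓡 n) 𝓘(ℝ, ℝ) ∞ v) (x : M) (X : TangentSpace (𝓡 n) x) :
    diff n (fun y => u y * v y) x X = u x * diff n v x X + diff n u x X * v x :=
  diff_smul hu hv x X

theorem smooth_sum {ι : Type*} (s : Finset ι) {g : ι → M → G}
    (hg : ∀ i ∈ s, ContMDiff (𝓡 n) 𝓘(ℝ, G) ∞ (g i)) :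
    ContMDiff (𝓡 n) 𝓘(ℝ, G) ∞ fun y => ∑ i ∈ s, g i y :=
  contMDiff_finsetSum fun i hi => hg i hi

theorem diff_const (c : G) (x : M) (X : TangentSpace (𝓡 n) x) :
    diff n (fun _ : M => c) x X = 0 := by
  have H : HasFDerivAt ((fun _ : M => c) ∘ (extChartAt (𝓡 n) x).symm) (0 : Eucl n →L[ℝ] G)
    (extChartAt (𝓡 n) x x) := hasFDerivAt_const c _
  rw [diff_eq_chartDiff contMDiff_const, (hasFDerivAt_chart contMDiff_const x).unique H]
  rfl

theorem diff_sum {ι : Type*} (s : Finset ι) {g : ι → M → G}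
    (hg : ∀ i ∈ s, ContMDiff (𝓡 n) 𝓘(ℝ, G) ∞ (g i)) (x : M) (X : TangentSpace (𝓡 n) x) :
    diff n (fun y => ∑ i ∈ s, g i y) x X = ∑ i ∈ s, diff n (g i) x X := by
  classical
  induction s using Finset.induction_on with
  | empty => simpa using! diff_const (0 : G) x X
  | insert a s ha ih =>
    simp only [Finset.sum_insert ha]
    rw [diff_add (hg a (by simp)) (smooth_sum s fun i hi => hg i (by simp [hi])),
      ih fun i hi => hg i (by simp [hi])]

theorem smooth_const_smul {g : M → G} (c : ℝ) (hg : ContMDiff (𝓡 n) 𝓘(ℝ, G) ∞ g) :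
    ContMDiff (𝓡 n) 𝓘(ℝ, G) ∞ fun y => c • g y := by
  have hc : ContMDiff (𝓡 n) 𝓘(ℝ, ℝ) ∞ fun _ : M => c := contMDiff_const
  exact hc.smul hg

theorem diff_const_smul {g : M → G} (c : ℝ) (hg : ContMDiff (𝓡 n) 𝓘(ℝ, G) ∞ g)
    (x : M) (X : TangentSpace (𝓡 n) x) :
    diff n (fun y => c • g y) x X = c • diff n g x X := by
  rw [diff_smul contMDiff_const hg, diff_const, zero_smul, add_zero]

theorem smooth_inner {g h : M → H} (hg : ContMDiff (𝓡 n) 𝓘(ℝ, H) ∞ g)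
    (hh : ContMDiff (𝓡 n) 𝓘(ℝ, H) ∞ h) :
    ContMDiff (𝓡 n) 𝓘(ℝ, ℝ) ∞ fun y => (inner ℝ (g y) (h y) : ℝ) :=
  (contDiff_inner (𝕜 := ℝ) (E := H) (n := ∞)).contMDiff.comp (hg.prodMk_space hh)

theorem diff_inner {g h : M → H} (hg : ContMDiff (𝓡 n) 𝓘(ℝ, H) ∞ g)
    (hh : ContMDiff (𝓡 n) 𝓘(ℝ, H) ∞ h) (x : M) (X : TangentSpace (𝓡 n) x) :
    diff n (fun y => (inner ℝ (g y) (h y) : ℝ)) x X =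
      inner ℝ (g x) (diff n h x X) + inner ℝ (diff n g x X) (h x) := by
  have H := (hasFDerivAt_chart hg x).inner ℝ (hasFDerivAt_chart hh x)
  rw [diff_eq_chartDiff (smooth_inner hg hh), diff_eq_chartDiff hg, diff_eq_chartDiff hh,
    (hasFDerivAt_chart (smooth_inner hg hh) x).unique H, comp_chart_apply, comp_chart_apply]
  rfl

theorem diff_congr {g h : M → G} {x : M} (e : g =ᶠ[𝓝 x] h) (X : TangentSpace (𝓡 n) x) :
    diff n g x X = diff n h x X := by
  unfold diff
  rw [e.mfderiv_eq]

variable [IsManifold (𝓡 n) ∞ M]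

/-- Near any point the differential of a smooth map factors, through isomorphisms of the tangent
spaces with the model space, as a smooth family of linear maps on the model space. -/
theorem exists_smooth_diff {g : M → G} (hg : ContMDiff (𝓡 n) 𝓘(ℝ, G) ∞ g) (x₀ : M) :
    ∃ E : M → Eucl n →L[ℝ] G, ContMDiffAt (𝓡 n) 𝓘(ℝ, Eucl n →L[ℝ] G) ∞ E x₀ ∧
      ∀ᶠ x in 𝓝 x₀, ∃ A : TangentSpace (𝓡 n) x ≃L[ℝ] Eucl n,
        ∀ X, diff n g x X = E x (A X) := by
  set φ := extChartAt (𝓡 n) x₀ with hφ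
  have hsm : ContDiffOn ℝ ∞ (g ∘ φ.symm) φ.target := by
    rw [← contMDiffOn_iff_contDiffOn]
    exact hg.comp_contMDiffOn (contMDiffOn_extChartAt_symm x₀)
  have hopen : IsOpen φ.target := isOpen_extChartAt_target x₀
  have hd : ContDiffOn ℝ ∞ (fderiv ℝ (g ∘ φ.symm)) φ.target :=
    hsm.fderiv_of_isOpen hopen (by simp)
  refine ⟨fun x => fderiv ℝ (g ∘ φ.symm) (φ x), ?_, ?_⟩
  · have h1 : ContDiffAt ℝ ∞ (fderiv ℝ (g ∘ φ.symm)) (φ x₀) :=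
      hd.contDiffAt (hopen.mem_nhds (mem_extChartAt_target x₀))
    exact h1.contMDiffAt.comp x₀ contMDiffAt_extChartAt
  · filter_upwards [extChartAt_source_mem_nhds (I := 𝓡 n) x₀] with x hx
    obtain ⟨A, hA⟩ := isInvertible_mfderiv_extChartAt (I := 𝓡 n) hx
    refine ⟨A, fun X => ?_⟩
    have e : g =ᶠ[𝓝 x] (g ∘ φ.symm) ∘ φ := by
      filter_upwards [(isOpen_extChartAt_source (I := 𝓡 n) x₀).mem_nhds hx] with y hy
      simp [φ.left_inv hy]
    have hx' : φ x ∈ φ.target := φ.map_source hx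
    have h2 : MDifferentiableAt 𝓘(ℝ, Eucl n) 𝓘(ℝ, G) (g ∘ φ.symm) (φ x) :=
      ((hsm.differentiableOn (by simp)).differentiableAt
        (hopen.mem_nhds hx')).mdifferentiableAt
    have h3 : MDifferentiableAt (𝓡 n) 𝓘(ℝ, Eucl n) φ x :=
      mdifferentiableAt_extChartAt (by simpa [hφ] using hx)
    unfold diff
    rw [e.mfderiv_eq, mfderiv_comp x h2 h3, mfderiv_eq_fderiv]
    have hAX := congrArg (fun L => L X) hA
    exact congrArg (fderiv ℝ (g ∘ φ.symm) (φ x)) hAX.symm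

/-- A smooth map on a connected manifold is constant as soon as its differential vanishes on a
dense set. -/
theorem eq_of_diff_eq_zero_of_dense [PreconnectedSpace M] {g : M → G}
    (hg : ContMDiff (𝓡 n) 𝓘(ℝ, G) ∞ g) {s : Set M} (hs : Dense s)
    (h : ∀ x ∈ s, ∀ X, diff n g x X = 0) (x y : M) : g x = g y := by
  -- the differential vanishes everywhere, by continuity
  have h0 : ∀ x, ∀ X, diff n g x X = 0 := by
    intro x₀
    obtain ⟨E, hE, hA⟩ := exists_smooth_diff hg x₀
    have hE0 : E x₀ = 0 := by
      by_contra hne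
      have h1 : ∀ᶠ x in 𝓝 x₀, E x ≠ 0 := hE.continuousAt.eventually_ne hne
      obtain ⟨x, hxs, hx1, A, hAx⟩ := (mem_closure_iff_frequently.1 (hs x₀)).and_eventually
        (h1.and hA) |>.exists
      refine hx1 (ContinuousLinearMap.ext fun v => ?_)
      have := hAx (A.symm v)
      rw [h x hxs, A.apply_symm_apply] at this
      simpa using this.symm
    obtain ⟨A, hAx⟩ := hA.self_of_nhds
    intro X
    rw [hAx, hE0]; rfl
  refine IsLocallyConstant.apply_eq_of_preconnectedSpace
    ((IsLocallyConstant.iff_eventually_eq g).2 fun x₀ => ?_) x y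
  set φ := extChartAt (𝓡 n) x₀ with hφ
  have hsm : ContDiffOn ℝ ∞ (g ∘ φ.symm) φ.target := by
    rw [← contMDiffOn_iff_contDiffOn]
    exact hg.comp_contMDiffOn (contMDiffOn_extChartAt_symm x₀)
  have hopen : IsOpen φ.target := isOpen_extChartAt_target x₀
  have hz : φ.target.EqOn (fderiv ℝ (g ∘ φ.symm)) 0 := by
    intro z hz
    have h1 : MDifferentiableAt (𝓡 n) 𝓘(ℝ, G) g (φ.symm z) := (hg _).mdifferentiableAt (by simp)
    have h2 : MDifferentiableAt 𝓘(ℝ, Eucl n) (𝓡 n) φ.symm z :=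
      ((contMDiffOn_extChartAt_symm (n := ∞) x₀).contMDiffAt
        (hopen.mem_nhds hz)).mdifferentiableAt (by simp)
    rw [← mfderiv_eq_fderiv, mfderiv_comp z h1 h2]
    ext v
    exact h0 _ _
  have ho := hopen.isOpen_inter_preimage_of_fderiv_eq_zero
    (hsm.differentiableOn (by simp)) hz {g x₀}
  have hm : φ x₀ ∈ φ.target ∩ (g ∘ φ.symm) ⁻¹' {g x₀} :=
    ⟨mem_extChartAt_target x₀, by simp [hφ]⟩
  filter_upwards [(continuousAt_extChartAt (I := 𝓡 n) x₀).preimage_mem_nhds (ho.mem_nhds hm),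
    extChartAt_source_mem_nhds (I := 𝓡 n) x₀] with y hy hys
  have h1 : g (φ.symm (φ y)) = g x₀ := hy.2
  rwa [φ.left_inv hys] at h1

theorem eq_of_diff_eq_zero [PreconnectedSpace M] {g : M → G}
    (hg : ContMDiff (𝓡 n) 𝓘(ℝ, G) ∞ g) (h : ∀ x X, diff n g x X = 0) (x y : M) : g x = g y :=
  eq_of_diff_eq_zero_of_dense hg dense_univ (fun x _ => h x) x y

end DifferentialCalculus

/-! ### Projection to the tangent spaces, and data as pairs -/

section RangeProjection

variable {V W : Type*} [NormedAddCommGroup V] [NormedSpace ℝ V] [FiniteDimensional ℝ V]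
  [NormedAddCommGroup W] [InnerProductSpace ℝ W]

/-- The real inner product of `W` as a continuous bilinear map. -/
noncomputable def innerCLM (W : Type*) [NormedAddCommGroup W] [InnerProductSpace ℝ W] :
    W →L[ℝ] W →L[ℝ] ℝ :=
  (isBoundedBilinearMap_inner (𝕜 := ℝ) (E := W)).toContinuousLinearMap

/-- The Gram form `(v, w) ↦ ⟨E v, E w⟩` of a linear map `E`, as a map into the dual. -/
noncomputable def gram (E : V →L[ℝ] W) : V →L[ℝ] V →L[ℝ] ℝ :=
  ((ContinuousLinearMap.compL ℝ V W ℝ).flip E).comp ((innerCLM W).comp E)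

omit [FiniteDimensional ℝ V] in
theorem gram_apply (E : V →L[ℝ] W) (v w : V) : gram E v w = inner ℝ (E v) (E w) := rfl

theorem gram_isInvertible {E : V →L[ℝ] W} (hE : Function.Injective E) :
    (gram E).IsInvertible := by
  have hinj : Function.Injective (gram E : V →ₗ[ℝ] V →L[ℝ] ℝ) := by
    rw [← LinearMap.ker_eq_bot, LinearMap.ker_eq_bot']
    intro v hv
    have h : gram E v v = 0 := by
      rw [show gram E v = 0 from hv]; rfl
    rw [gram_apply, inner_self_eq_zero] at h
    exact hE (by simpa using h)
  have hrank : Module.finrank ℝ V = Module.finrank ℝ (V →L[ℝ] ℝ) := by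
    rw [← LinearMap.toContinuousLinearMap (𝕜 := ℝ) (E := V) (F' := ℝ) |>.finrank_eq]
    exact (Subspace.dual_finrank_eq).symm
  have : FiniteDimensional ℝ (V →L[ℝ] ℝ) :=
    LinearEquiv.finiteDimensional (LinearMap.toContinuousLinearMap (𝕜 := ℝ) (E := V) (F' := ℝ))
  exact ⟨(LinearMap.linearEquivOfInjective _ hinj hrank).toContinuousLinearEquiv, by
    ext v w; rfl⟩

/-- The orthogonal projection onto the range of an injective `E`, through the normal equations. -/
theorem starProjection_range_eq {E : V →L[ℝ] W} (hE : Function.Injective E) (y : W) :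
    (LinearMap.range E.toLinearMap).starProjection y =
      E ((gram E).inverse (((innerCLM W) y).comp E)) := by
  obtain ⟨A, hA⟩ := gram_isInvertible hE
  refine Submodule.eq_starProjection_of_mem_of_inner_eq_zero
    (LinearMap.mem_range_self E.toLinearMap _) ?_
  rintro _ ⟨w, rfl⟩
  rw [← hA, ContinuousLinearMap.inverse_equiv]
  have h : gram E (A.symm (((innerCLM W) y).comp E)) w = inner ℝ y (E w) := by
    rw [← hA]
    simp only [ContinuousLinearEquiv.coe_coe, ContinuousLinearEquiv.apply_symm_apply]
    rfl
  rw [gram_apply] at h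
  rw [inner_sub_left, sub_eq_zero]
  exact h.symm

theorem contDiffAt_range_projection {E : V →L[ℝ] W} (hE : Function.Injective E) (y : W) :
    ContDiffAt ℝ ∞ (fun p : (V →L[ℝ] W) × W =>
      p.1 ((gram p.1).inverse (((innerCLM W) p.2).comp p.1))) (E, y) := by
  have h1 : ContDiff ℝ ∞ fun p : (V →L[ℝ] W) × W => gram p.1 :=
    ((ContinuousLinearMap.contDiff _).comp contDiff_fst).clm_comp
      (contDiff_const.clm_comp contDiff_fst)
  have h2 : ContDiffAt ℝ ∞ (fun p : (V →L[ℝ] W) × W => (gram p.1).inverse) (E, y) :=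
    ContDiffAt.comp (g := ContinuousLinearMap.inverse) (E, y)
      (gram_isInvertible hE).contDiffAt_map_inverse h1.contDiffAt
  have h3 : ContDiff ℝ ∞ fun p : (V →L[ℝ] W) × W => ((innerCLM W) p.2).comp p.1 :=
    ((innerCLM W).contDiff.comp contDiff_snd).clm_comp contDiff_fst
  exact contDiff_fst.contDiffAt.clm_apply (h2.clm_apply h3.contDiffAt)

end RangeProjection

section Data

open Filter Topology

variable {n N : ℕ} {M : Type*} [TopologicalSpace M] [ChartedSpace (Eucl n) M]
  {f : M → Eucl N}

theorem tangentPart_add_normalPart (f : M → Eucl N) (x : M) (y : Eucl N) :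
    tangentPart n f x y + normalPart n f x y = y :=
  (tangentPlane n f x).starProjection_add_starProjection_orthogonal y

theorem diff_mem_tangentPlane (f : M → Eucl N) (x : M) (X : TangentSpace (𝓡 n) x) :
    diff n f x X ∈ tangentPlane n f x := ⟨X, rfl⟩

theorem tangentPart_of_mem {x : M} {y : Eucl N} (hy : y ∈ tangentPlane n f x) :
    tangentPart n f x y = y :=
  Submodule.starProjection_eq_self_iff.2 hy

theorem normalPart_of_mem {x : M} {y : Eucl N} (hy : y ∈ tangentPlane n f x) :
    normalPart n f x y = 0 := by
  have := tangentPart_add_normalPart (n := n) f x y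
  rw [tangentPart_of_mem hy] at this
  simpa using this

/-- The tangential component of a smooth vector field along an immersion is smooth. -/
theorem smooth_tangentPart [IsManifold (𝓡 n) ∞ M] (hf : IsSmoothImmersion n f)
    {F : M → Eucl N} (hF : ContMDiff (𝓡 n) 𝓘(ℝ, Eucl N) ∞ F) :
    ContMDiff (𝓡 n) 𝓘(ℝ, Eucl N) ∞ fun x => tangentPart n f x (F x) := by
  intro x₀
  obtain ⟨E, hE, hA⟩ := exists_smooth_diff hf.1 x₀
  have key : ∀ x, (∃ A : TangentSpace (𝓡 n) x ≃L[ℝ] Eucl n, ∀ X, diff n f x X = E x (A X)) →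
      Function.Injective (E x) ∧
        tangentPlane n f x = LinearMap.range (E x).toLinearMap := by
    rintro x ⟨A, hAx⟩
    constructor
    · intro v w hvw
      have h1 : diff n f x (A.symm v) = diff n f x (A.symm w) := by
        rw [hAx, hAx]; simpa using hvw
      exact A.symm.injective (hf.2 x h1)
    · ext y
      constructor
      · rintro ⟨X, rfl⟩
        exact ⟨A X, (hAx X).symm⟩
      · rintro ⟨v, rfl⟩
        refine ⟨A.symm v, ?_⟩
        have := hAx (A.symm v)
        rw [A.apply_symm_apply] at this
        exact this
  have hc := (contDiffAt_range_projection (key x₀ hA.self_of_nhds).1 (F x₀)).contMDiffAt.comp x₀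
    (hE.prodMk_space (hF x₀))
  refine hc.congr_of_eventuallyEq ?_
  filter_upwards [hA] with x hx
  obtain ⟨h1, h2⟩ := key x hx
  simp only [Function.comp_apply, tangentPart]
  rw [← starProjection_range_eq h1]
  congr 2

theorem Datum.smooth_F (d : Datum n f) : ContMDiff (𝓡 n) 𝓘(ℝ, Eucl N) ∞ d.F :=
  d.smooth_grad.add d.smooth_β

theorem Datum.inner_F (d : Datum n f) (x : M) (X : TangentSpace (𝓡 n) x) :
    inner ℝ (d.F x) (diff n f x X) = diff n d.φ x X := by
  rw [Datum.F, inner_add_left, d.grad_spec,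
    Submodule.inner_left_of_mem_orthogonal (diff_mem_tangentPlane f x X) (d.normal_β x), add_zero]

/-- The defining equation of a datum says that `F` is a Combescure transform of `f`: its
differential is tangent to `f`, and equal to `f_*` composed with the Codazzi tensor. -/
theorem Datum.diff_F (d : Datum n f) (x : M) (X : TangentSpace (𝓡 n) x) :
    diff n d.F x X = diff n f x (d.Φ x X) := by
  have h1 : diff n d.F x X = diff n (push n f d.grad) x X + diff n d.β x X :=
    diff_add d.smooth_grad d.smooth_β x X
  have h2 := d.normal_eq x X
  rw [secondFundamentalForm, normalDeriv, ← map_add, ← h1] at h2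
  have h3 := d.Φ_spec x X
  rw [pushLeviCivita, pushShape, sub_neg_eq_add, ← map_add, ← h1] at h3
  have h4 := tangentPart_add_normalPart (n := n) f x (diff n d.F x X)
  rw [h2, add_zero] at h4
  rw [h3, h4]

/-- Data may be prescribed by the pair `(φ, F)`. -/
theorem exists_datum [IsManifold (𝓡 n) ∞ M] (hf : IsSmoothImmersion n f)
    {φ : M → ℝ} {F : M → Eucl N} (hφ : ContMDiff (𝓡 n) 𝓘(ℝ, ℝ) ∞ φ)
    (hF : ContMDiff (𝓡 n) 𝓘(ℝ, Eucl N) ∞ F)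
    (hφF : ∀ x X, inner ℝ (F x) (diff n f x X) = diff n φ x X)
    (hdF : ∀ x X, ∃ Z, diff n F x X = diff n f x Z) :
    ∃ d : Datum n f, d.φ = φ ∧ d.F = F := by
  have hgrad : ∀ x, ∃ Z, diff n f x Z = tangentPart n f x (F x) := fun x =>
    Submodule.starProjection_apply_mem (tangentPlane n f x) (F x)
  choose Z hZ using hgrad
  have hpush : push n f Z = fun x => tangentPart n f x (F x) := funext hZ
  have hsm : ContMDiff (𝓡 n) 𝓘(ℝ, Eucl N) ∞ (push n f Z) := hpush ▸ smooth_tangentPart hf hF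
  have hβ : (fun x => normalPart n f x (F x)) = fun x => F x - push n f Z x := by
    funext x
    rw [hpush, eq_sub_iff_add_eq, add_comm]
    exact tangentPart_add_normalPart (n := n) f x (F x)
  have hβs : ContMDiff (𝓡 n) 𝓘(ℝ, Eucl N) ∞ fun x => normalPart n f x (F x) := by
    rw [hβ]; exact hF.sub hsm
  have hsum : ∀ x X, diff n (push n f Z) x X + diff n (fun y => normalPart n f y (F y)) x X
      = diff n F x X := by
    intro x X
    rw [hβ, diff_sub hF hsm]; abel
  have hmem : ∀ x X, diff n F x X ∈ tangentPlane n f x := fun x X => by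
    obtain ⟨Y, hY⟩ := hdF x X
    rw [hY]; exact diff_mem_tangentPlane f x Y
  have hinv : ∀ x, ∃ g : Eucl N →ₗ[ℝ] TangentSpace (𝓡 n) x,
      g ∘ₗ (diff n f x).toLinearMap = LinearMap.id := fun x =>
    LinearMap.exists_leftInverse_of_injective _ (LinearMap.ker_eq_bot.2 (hf.2 x))
  choose g hg using hinv
  have hnorm : ∀ x, normalPart n f x (F x) ∈ (tangentPlane n f x)ᗮ := fun x =>
    Submodule.starProjection_apply_mem _ _
  refine ⟨{
    φ := φ
    β := fun x => normalPart n f x (F x)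
    smooth_φ := hφ
    smooth_β := hβs
    normal_β := hnorm
    grad := Z
    smooth_grad := hsm
    grad_spec := fun x X => ?_
    normal_eq := fun x X => ?_
    Φ := fun x => (LinearMap.toContinuousLinearMap (g x)).comp (diff n F x)
    Φ_spec := fun x X => ?_ }, rfl, funext fun x => ?_⟩
  · rw [← hφF, ← tangentPart_add_normalPart (n := n) f x (F x), inner_add_left,
      Submodule.inner_left_of_mem_orthogonal (diff_mem_tangentPlane f x X) (hnorm x), add_zero,
      hpush]
  · rw [secondFundamentalForm, normalDeriv, ← map_add, hsum, normalPart_of_mem (hmem x X)]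
  · rw [pushLeviCivita, pushShape, sub_neg_eq_add, ← map_add, hsum, tangentPart_of_mem (hmem x X)]
    obtain ⟨Y, hY⟩ := hdF x X
    have h1 : g x (diff n f x Y) = Y := LinearMap.congr_fun (hg x) Y
    change diff n f x (g x (diff n F x X)) = _
    rw [hY, h1]
  · change push n f Z x + normalPart n f x (F x) = F x
    rw [hpush]
    exact tangentPart_add_normalPart (n := n) f x (F x)

end Data

/-! ### Scalar transforms: uniqueness of the datum, and inverse transforms -/

section Factorization

variable {V W : Type*} [AddCommGroup V] [Module ℝ V]

/-- If `K ∘ D` is injective, then so is `D`, which is thus bijective on a finite-dimensional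
space. Below `L` is the differential of a transform, and `K` is the differential
of the given immersion followed by a reflection. -/
theorem injective_of_factor {L : V → W} {K : V → W} {D : V →ₗ[ℝ] V}
    (hL : Function.Injective L) (h : ∀ X, L X = K (D X)) : Function.Injective D := by
  intro X Y hXY
  exact hL (by rw [h, h, hXY])

theorem exists_of_factor [FiniteDimensional ℝ V] {L : V → W} {K : V → W} {D : V →ₗ[ℝ] V}
    (hL : Function.Injective L) (h : ∀ X, L X = K (D X)) (Y : V) : ∃ Z, K Y = L Z := by
  obtain ⟨Z, rfl⟩ := LinearMap.surjective_of_injective (injective_of_factor hL h) Y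
  exact ⟨Z, (h Z).symm⟩

theorem eq_of_factor [FiniteDimensional ℝ V] {L : V → W} {K : V → W} {D : V →ₗ[ℝ] V}
    (hL : Function.Injective L) (h : ∀ X, L X = K (D X)) {Y Z : V} (hYZ : L Z = K Y) :
    D Z = Y := by
  obtain ⟨Z', rfl⟩ := LinearMap.surjective_of_injective (injective_of_factor hL h) Y
  rw [← h] at hYZ
  rw [hL hYZ]

theorem apply_comm_of_factor {D T : V →ₗ[ℝ] V} {B Ψ : V → V} (hD : Function.Injective D)
    (hΨ : ∀ X, D (Ψ X) = B X) (hTD : ∀ X, T (D X) = D (T X)) (hTB : ∀ X, T (B X) = B (T X))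
    (X : V) : T (Ψ X) = Ψ (T X) :=
  hD (by rw [← hTD, hΨ, hΨ, hTB])

end Factorization

instance finiteDimensional_tangentSpace (n : ℕ) {M : Type*} [TopologicalSpace M] [ChartedSpace (Eucl n) M] (x : M) :
    FiniteDimensional ℝ (TangentSpace (𝓡 n) x) :=
  inferInstanceAs (FiniteDimensional ℝ (Eucl n))

section ScalarTransforms

open Filter Topology

variable {n N : ℕ} {M : Type*} [TopologicalSpace M] [ChartedSpace (Eucl n) M]
  {f g : M → Eucl N}

theorem Datum.inner_F_ne_zero {d : Datum n f} (hd : d.Determines g) (x : M) :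
    (inner ℝ (d.F x) (d.F x) : ℝ) ≠ 0 :=
  _root_.inner_self_ne_zero.2 (hd.2.2.1 x)

theorem smooth_inv {u : M → ℝ} (hu : ContMDiff (𝓡 n) 𝓘(ℝ, ℝ) ∞ u) (h0 : ∀ x, u x ≠ 0) :
    ContMDiff (𝓡 n) 𝓘(ℝ, ℝ) ∞ fun x => (u x)⁻¹ := fun x =>
  ((contDiffAt_inv ℝ (h0 x)).contMDiffAt (n := ∞)).comp x (hu x)

/-- Where `dφ = 0`, the field `F` is normal to `f`, whereas the differentials of all such fields are
tangent. -/
theorem Datum.diff_F_inner_eq_zero (d e : Datum n f) {x : M}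
    (hx : ∀ X, diff n e.φ x X = 0) (X : TangentSpace (𝓡 n) x) :
    inner ℝ (e.F x) (diff n d.F x X) = 0 := by
  rw [d.diff_F, e.inner_F, hx]

variable [IsManifold (𝓡 n) ∞ M]

/-- The datum of a Ribaucour transform is unique up to a constant factor, unless its function
vanishes identically. -/
theorem Datum.proportional [PreconnectedSpace M] {d e : Datum n f} (hd : d.Determines g)
    (he : e.Determines g) {x₀ : M} (hx₀ : d.φ x₀ ≠ 0) :
    ∃ c : ℝ, c ≠ 0 ∧ (∀ x, e.φ x = c * d.φ x) ∧ ∀ x, e.F x = c • d.F x := by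
  have hd0 := Datum.inner_F_ne_zero hd
  have he0 := Datum.inner_F_ne_zero he
  have hdd := smooth_inner d.smooth_F d.smooth_F
  have hde := smooth_inner d.smooth_F e.smooth_F
  set l : M → ℝ := fun x => (inner ℝ (d.F x) (d.F x))⁻¹ * inner ℝ (d.F x) (e.F x) with hl
  have hls : ContMDiff (𝓡 n) 𝓘(ℝ, ℝ) ∞ l := (smooth_inv hdd hd0).mul hde
  have hl1 : ∀ x, l x * inner ℝ (d.F x) (d.F x) = inner ℝ (d.F x) (e.F x) := fun x => by
    rw [hl, mul_right_comm, inv_mul_cancel₀ (hd0 x), one_mul]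
  have heq : ∀ x, (((1 / 2 : ℝ) * inner ℝ (d.F x) (d.F x))⁻¹ * d.φ x) • d.F x =
      (((1 / 2 : ℝ) * inner ℝ (e.F x) (e.F x))⁻¹ * e.φ x) • e.F x := fun x => by
    have h := (hd.2.2.2 x).symm.trans (he.2.2.2 x)
    exact sub_right_injective h
  have hzero : ∀ x, d.φ x = 0 → e.φ x = 0 := fun x hx => by
    have h := heq x
    rw [hx, mul_zero, zero_smul, eq_comm, smul_eq_zero] at h
    rcases h with h | h
    · rcases mul_eq_zero.1 h with h | h
      · exact absurd h (inv_ne_zero (mul_ne_zero (by norm_num) (he0 x)))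
      · exact h
    · exact absurd h (he.2.2.1 x)
  -- where `φ ≠ 0`, the difference `f - g` recovers the ratio of the two data
  have hne : ∀ x, d.φ x ≠ 0 → e.F x = l x • d.F x ∧ e.φ x = l x * d.φ x := fun x hx => by
    have h := heq x
    have hφ : e.φ x ≠ 0 := by
      intro h0
      rw [h0, mul_zero, zero_smul, smul_eq_zero] at h
      rcases h with h | h
      · rcases mul_eq_zero.1 h with h | h
        · exact inv_ne_zero (mul_ne_zero (by norm_num) (hd0 x)) h
        · exact hx h
      · exact hd.2.2.1 x h
    set A := inner ℝ (d.F x) (d.F x) with hA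
    set B := inner ℝ (e.F x) (e.F x) with hB
    have hA0 : A ≠ 0 := hd0 x
    have hB0 : B ≠ 0 := he0 x
    obtain ⟨r, hr⟩ : ∃ r : ℝ, e.F x = r • d.F x := by
      refine ⟨(((1 / 2 : ℝ) * B)⁻¹ * e.φ x)⁻¹ * (((1 / 2 : ℝ) * A)⁻¹ * d.φ x), ?_⟩
      rw [mul_smul, h, inv_smul_smul₀]
      exact mul_ne_zero (inv_ne_zero (mul_ne_zero (by norm_num) hB0)) hφ
    have hlr : l x = r := by
      have h1 := hl1 x
      rw [hr, inner_smul_right, ← hA] at h1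
      exact mul_right_cancel₀ hA0 h1
    have hr0 : r ≠ 0 := by
      rintro rfl
      exact he.2.2.1 x (by rw [hr, zero_smul])
    refine ⟨hlr ▸ hr, ?_⟩
    have hBA : B = r * (r * A) := by
      rw [hB, hr, inner_smul_left, inner_smul_right, ← hA]; simp
    rw [hr, smul_smul] at h
    have h2 := smul_left_injective ℝ (hd.2.2.1 x) h
    rw [hBA] at h2
    field_simp at h2
    rw [hlr, mul_comm]; linarith
  -- the set where `φ ≠ 0`, together with the interior of its complement, is dense
  set U : Set M := {x | d.φ x ≠ 0} with hU
  have hUo : IsOpen U := isOpen_ne_fun d.smooth_φ.continuous continuous_const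
  have hdense : Dense (U ∪ interior Uᶜ) := by
    rw [interior_compl]
    intro x
    by_cases hx : x ∈ closure U
    · exact closure_mono Set.subset_union_left hx
    · exact subset_closure (Or.inr hx)
  have hint : ∀ x ∈ interior Uᶜ, (∀ X, diff n d.φ x X = 0) ∧ ∀ X, diff n e.φ x X = 0 := by
    intro x hx
    have h1 : d.φ =ᶠ[𝓝 x] fun _ => 0 := by
      filter_upwards [mem_interior_iff_mem_nhds.1 hx] with y hy
      simpa [hU] using hy
    have h2 : e.φ =ᶠ[𝓝 x] fun _ => 0 := by
      filter_upwards [h1] with y hy using hzero y hy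
    exact ⟨fun X => by rw [diff_congr h1, diff_const], fun X => by rw [diff_congr h2, diff_const]⟩
  have hlc : ∀ x, l x = l x₀ := fun x => by
    refine eq_of_diff_eq_zero_of_dense hls hdense ?_ x x₀
    rintro y (hy | hy) X
    · have h1 : e.φ =ᶠ[𝓝 y] fun z => l z * d.φ z := by
        filter_upwards [hUo.mem_nhds hy] with z hz using (hne z hz).2
      have h2 := diff_congr h1 X
      rw [diff_mul hls d.smooth_φ, ← e.inner_F, ← d.inner_F, (hne y hy).1, inner_smul_left] at h2
      simpa [show d.φ y ≠ 0 from hy] using h2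
    · obtain ⟨h1, h2⟩ := hint y hy
      have h3 : diff n (fun z => l z * inner ℝ (d.F z) (d.F z)) y X =
          diff n (fun z => (inner ℝ (d.F z) (e.F z) : ℝ)) y X := by
        simp_rw [hl1]
      rw [diff_mul hls hdd, diff_inner d.smooth_F d.smooth_F, diff_inner d.smooth_F e.smooth_F,
        real_inner_comm (d.F y) (diff n d.F y X), real_inner_comm (e.F y) (diff n d.F y X),
        d.diff_F_inner_eq_zero d h1, e.diff_F_inner_eq_zero d h1, d.diff_F_inner_eq_zero e h2] at h3
      rw [add_zero, mul_zero, zero_add] at h3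
      exact (mul_eq_zero.1 h3).resolve_right (hd0 y)
  have hG : ∀ x, e.F x = l x₀ • d.F x := by
    have hs : ContMDiff (𝓡 n) 𝓘(ℝ, Eucl N) ∞ fun y => l x₀ • d.F y :=
      smooth_const_smul _ d.smooth_F
    have hds : ContMDiff (𝓡 n) 𝓘(ℝ, Eucl N) ∞ fun y => e.F y - l x₀ • d.F y := e.smooth_F.sub hs
    have h0 : ∀ x, (inner ℝ (e.F x - l x₀ • d.F x) (e.F x - l x₀ • d.F x) : ℝ) = 0 := fun x => by
      have h1 := eq_of_diff_eq_zero_of_dense (smooth_inner hds hds) hdense (fun y hy X => ?_) x x₀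
      · rw [h1, (hne x₀ hx₀).1]; simp
      · rw [diff_inner hds hds, diff_sub e.smooth_F hs, diff_const_smul _ d.smooth_F]
        rcases hy with hy | hy
        · rw [(hne y hy).1, hlc y]; simp
        · obtain ⟨h1, h2⟩ := hint y hy
          rw [real_inner_comm]
          simp only [inner_sub_left, inner_sub_right, inner_smul_left, inner_smul_right]
          simp only [real_inner_comm (d.F y) (diff n d.F y X),
            real_inner_comm (d.F y) (diff n e.F y X), real_inner_comm (e.F y) (diff n d.F y X),
            real_inner_comm (e.F y) (diff n e.F y X), d.diff_F_inner_eq_zero d h1,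
            e.diff_F_inner_eq_zero d h1, d.diff_F_inner_eq_zero e h2,
            e.diff_F_inner_eq_zero e h2]
          simp
    intro x
    exact sub_eq_zero.1 (inner_self_eq_zero.1 (h0 x))
  refine ⟨l x₀, ?_, fun x => ?_, hG⟩
  · intro h0
    exact he.2.2.1 x₀ (by rw [hG, h0, zero_smul])
  · by_cases hx : d.φ x = 0
    · rw [hx, hzero x hx, mul_zero]
    · rw [(hne x hx).2, hlc x]

/-- The inverse of a Ribaucour transformation is the Ribaucour transformation with
`(φ, F)` replaced by `(φ, -F)/Ω`, `Ω = ½⟨F, F⟩`. Its Codazzi tensor commutes with everything that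
commutes with the given one. -/
theorem Datum.exists_inverse {d : Datum n f} (hd : d.Determines g) :
    ∃ e : Datum n g, e.Determines f ∧ ∀ x (T : TangentSpace (𝓡 n) x →L[ℝ] TangentSpace (𝓡 n) x),
      (∀ X, T (d.Φ x X) = d.Φ x (T X)) → ∀ X, T (e.Φ x X) = e.Φ x (T X) := by
  have hd0 := Datum.inner_F_ne_zero hd
  have hdd := smooth_inner d.smooth_F d.smooth_F
  set w : M → ℝ := fun x => (1 / 2 : ℝ) * inner ℝ (d.F x) (d.F x) with hw
  have hws : ContMDiff (𝓡 n) 𝓘(ℝ, ℝ) ∞ w := smooth_const_smul _ hdd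
  have hw0 : ∀ x, w x ≠ 0 := fun x => mul_ne_zero (by norm_num) (hd0 x)
  have hdw : ∀ x X, diff n w x X = inner ℝ (d.F x) (diff n d.F x X) := fun x X => by
    rw [hw, diff_mul contMDiff_const hdd, diff_const, diff_inner d.smooth_F d.smooth_F,
      real_inner_comm (d.F x) (diff n d.F x X)]
    ring
  set r : M → ℝ := fun x => (w x)⁻¹ with hr
  have hrs : ContMDiff (𝓡 n) 𝓘(ℝ, ℝ) ∞ r := smooth_inv hws hw0
  have hr0 : ∀ x, r x ≠ 0 := fun x => inv_ne_zero (hw0 x)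
  have hrw : ∀ x, r x * w x = 1 := fun x => inv_mul_cancel₀ (hw0 x)
  have hFF : ∀ x, (inner ℝ (d.F x) (d.F x) : ℝ) = 2 * w x := fun x => by simp only [hw]; ring
  have hdr : ∀ x X, diff n r x X = -(r x * r x * inner ℝ (d.F x) (diff n d.F x X)) := by
    intro x X
    have h1 : diff n (fun y => r y * w y) x X = 0 := by
      simp_rw [hrw]; exact diff_const _ _ _
    rw [diff_mul hrs hws, hdw] at h1
    have h2 := congrArg (fun t => t * r x) h1
    have h3 := hrw x
    simp only [zero_mul] at h2
    linear_combination h2 - diff n r x X * h3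
  have hrφ : ContMDiff (𝓡 n) 𝓘(ℝ, ℝ) ∞ fun x => r x * d.φ x := hrs.mul d.smooth_φ
  have hg : g = fun x => f x - (r x * d.φ x) • d.F x := funext hd.2.2.2
  have hdg : ∀ x X, diff n g x X = diff n f x X - ((r x * d.φ x) • diff n d.F x X +
      (r x * diff n d.φ x X + diff n r x X * d.φ x) • d.F x) := fun x X => by
    have h2 : ContMDiff (𝓡 n) 𝓘(ℝ, Eucl N) ∞ fun x => (r x * d.φ x) • d.F x :=
      hrφ.smul d.smooth_F
    rw [hg, diff_sub hd.1.1 h2, diff_smul hrφ d.smooth_F, diff_mul hrs d.smooth_φ]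
  -- both differentials are reflections of vectors tangent to `f`
  set K : ∀ x : M, TangentSpace (𝓡 n) x → Eucl N := fun x X =>
    diff n f x X - (r x * inner ℝ (d.F x) (diff n f x X)) • d.F x with hK
  set D : ∀ x : M, TangentSpace (𝓡 n) x →ₗ[ℝ] TangentSpace (𝓡 n) x := fun x =>
    LinearMap.id - (r x * d.φ x) • (d.Φ x).toLinearMap with hD
  have hDX : ∀ x X, D x X = X - (r x * d.φ x) • d.Φ x X := fun x X => rfl
  have hgK : ∀ x X, diff n g x X = K x (D x X) := fun x X => by
    simp only [hK, hDX, map_sub, map_smul, ← d.diff_F, inner_sub_right, inner_smul_right]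
    rw [hdg, hdr, d.inner_F, sub_sub]
    congr 1
    module
  have hFs : ContMDiff (𝓡 n) 𝓘(ℝ, Eucl N) ∞ fun x => (-r x) • d.F x := hrs.neg.smul d.smooth_F
  have hFK : ∀ x X, diff n (fun y => (-r y) • d.F y) x X = K x ((-r x) • d.Φ x X) := fun x X => by
    have h1 : (fun y => (-r y) • d.F y) = fun y => (-1 : ℝ) • (r y • d.F y) := by
      funext y; module
    have h2 : ContMDiff (𝓡 n) 𝓘(ℝ, Eucl N) ∞ fun y => r y • d.F y := hrs.smul d.smooth_F
    rw [h1, diff_const_smul _ h2, diff_smul hrs d.smooth_F, hdr]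
    simp only [hK, map_smul, ← d.diff_F, inner_smul_right]
    module
  have hin : ∀ x X, inner ℝ ((-r x) • d.F x) (diff n g x X) =
      diff n (fun x => r x * d.φ x) x X := fun x X => by
    rw [hdg, diff_mul hrs d.smooth_φ, hdr]
    simp only [inner_smul_left, inner_sub_right, inner_add_right, inner_smul_right, hFF, d.inner_F]
    simp only [map_neg, conj_trivial]
    linear_combination (2 * r x * diff n d.φ x X -
      2 * r x * r x * d.φ x * inner ℝ (d.F x) (diff n d.F x X)) * hrw x
  obtain ⟨e, heφ, heF⟩ := exists_datum hd.2.1 hrφ hFs hin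
    (fun x X => by rw [hFK]; exact exists_of_factor (hd.2.1.2 x) (hgK x) _)
  · refine ⟨e, ⟨hd.2.1, hd.1, fun x => ?_, fun x => ?_⟩, fun x T hT X => ?_⟩
    · rw [heF]; exact smul_ne_zero (neg_ne_zero.2 (hr0 x)) (hd.2.2.1 x)
    · have h1 : (1 / 2 : ℝ) * inner ℝ (e.F x) (e.F x) = r x := by
        rw [heF]
        simp only [inner_smul_left, inner_smul_right, hFF]
        simp only [map_neg, conj_trivial]
        linear_combination r x * hrw x
      rw [h1, heφ, heF, hg]
      simp only [← mul_assoc, inv_mul_cancel₀ (hr0 x)]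
      module
    · refine apply_comm_of_factor (T := T.toLinearMap) (Ψ := e.Φ x) (D := D x)
        (B := fun X => (-r x) • d.Φ x X)
        (injective_of_factor (hd.2.1.2 x) (hgK x)) (fun Y => ?_) (fun Y => ?_) (fun Y => ?_) X
      · refine eq_of_factor (hd.2.1.2 x) (hgK x) ?_
        rw [← e.diff_F, heF]; exact hFK x Y
      · change T (D x Y) = D x (T Y)
        rw [hDX, hDX, map_sub, map_smul, hT]
      · change T ((-r x) • d.Φ x Y) = (-r x) • d.Φ x (T Y)
        rw [map_smul, hT]

end ScalarTransforms

/-! ### Principal subsystems and Schur complements -/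

section PrincipalSystems

variable {ι : Type*} [DecidableEq ι]

/-- The solution `w`, supported on `γ`, of the principal subsystem `∑ l, A i l * w l = b i`,
`i ∈ γ`. It is extended by zero to all of `ι`, so that sums run over the fixed type `ι`. -/
noncomputable def principalSolve (A : Matrix ι ι ℝ) (γ : Finset ι) (b : ι → ℝ) (l : ι) : ℝ :=
  if h : l ∈ γ then
    ((A.submatrix (Subtype.val : γ → ι) Subtype.val)⁻¹ *ᵥ fun j : γ => b j) ⟨l, h⟩
  else 0

/-- The principal minor of `A` on `γ` does not vanish. -/
def PrincipalRegular (A : Matrix ι ι ℝ) (γ : Finset ι) : Prop :=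
  (A.submatrix (Subtype.val : γ → ι) Subtype.val).det ≠ 0

theorem principalSolve_of_notMem {A : Matrix ι ι ℝ} {γ : Finset ι} {b : ι → ℝ} {l : ι}
    (h : l ∉ γ) : principalSolve A γ b l = 0 :=
  dif_neg h

theorem PrincipalRegular.transpose {A : Matrix ι ι ℝ} {γ : Finset ι}
    (hA : PrincipalRegular A γ) : PrincipalRegular Aᵀ γ := by
  unfold PrincipalRegular at *
  rwa [← Matrix.transpose_submatrix, Matrix.det_transpose]

theorem sum_eq_sum_coe {ι : Type*} [Fintype ι] {E : Type*} [AddCommMonoid E] {γ : Finset ι} {g : ι → E}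
    (h : ∀ l, l ∉ γ → g l = 0) : ∑ l, g l = ∑ l : γ, g l := by
  rw [Finset.sum_coe_sort γ g]
  exact (Finset.sum_subset (Finset.subset_univ γ) fun l _ hl => h l hl).symm

/-- The `2 × 2` principal block of `A` at the ordered pair `(i, j)`. -/
def pairBlock (A : Matrix ι ι ℝ) (i j : ι) : Matrix (Fin 2) (Fin 2) ℝ :=
  A.submatrix ![i, j] ![i, j]

theorem det_pairBlock_ne_zero {A : Matrix ι ι ℝ} {i j : ι} (hij : i ≠ j) :
    (pairBlock A i j).det ≠ 0 ↔ PrincipalRegular A {i, j} := by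
  let e : Fin 2 → ({i, j} : Finset ι) := ![⟨i, by simp⟩, ⟨j, by simp⟩]
  have he : Function.Bijective e := by
    constructor
    · intro p q hpq
      fin_cases p <;> fin_cases q <;> simp_all [e, hij.symm]
    · rintro ⟨l, hl⟩
      rcases Finset.mem_insert.1 hl with rfl | hl
      · exact ⟨0, rfl⟩
      · rw [Finset.mem_singleton] at hl
        subst hl
        exact ⟨1, rfl⟩
  have h : pairBlock A i j =
      (A.submatrix (Subtype.val : ({i, j} : Finset ι) → ι) Subtype.val).submatrix
        (Equiv.ofBijective e he) (Equiv.ofBijective e he) := by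
    ext p q
    fin_cases p <;> fin_cases q <;> rfl
  rw [h, Matrix.det_submatrix_equiv_self, PrincipalRegular]

variable [Fintype ι]

theorem sum_mul_principalSolve {A : Matrix ι ι ℝ} {γ : Finset ι} (hA : PrincipalRegular A γ)
    (b : ι → ℝ) {i : ι} (hi : i ∈ γ) : ∑ l, A i l * principalSolve A γ b l = b i := by
  rw [sum_eq_sum_coe (γ := γ) fun l hl => by rw [principalSolve_of_notMem hl, mul_zero]]
  have h : A.submatrix (Subtype.val : γ → ι) Subtype.val *ᵥ
      ((A.submatrix (Subtype.val : γ → ι) Subtype.val)⁻¹ *ᵥ fun j : γ => b j) =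
      fun j : γ => b j := by
    rw [Matrix.mulVec_mulVec, Matrix.mul_nonsing_inv _ (isUnit_iff_ne_zero.2 hA),
      Matrix.one_mulVec]
  have h1 := congrFun h ⟨i, hi⟩
  simp only [Matrix.mulVec, dotProduct, Matrix.submatrix_apply] at h1
  rw [← h1]
  refine Finset.sum_congr rfl fun l _ => ?_
  simp [principalSolve, Matrix.mulVec, dotProduct]

theorem eq_principalSolve {A : Matrix ι ι ℝ} {γ : Finset ι} (hA : PrincipalRegular A γ)
    {b w : ι → ℝ} (hw : ∀ l, l ∉ γ → w l = 0) (h : ∀ i ∈ γ, ∑ l, A i l * w l = b i) :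
    w = principalSolve A γ b := by
  funext l
  by_cases hl : l ∈ γ
  · have h1 : A.submatrix (Subtype.val : γ → ι) Subtype.val *ᵥ (fun j : γ => w j) =
        fun j : γ => b j := by
      funext i
      simp only [Matrix.mulVec, dotProduct, Matrix.submatrix_apply]
      rw [← h i i.2, sum_eq_sum_coe (γ := γ) fun l hl => by rw [hw l hl, mul_zero]]
    rw [principalSolve, dif_pos hl, ← h1, Matrix.mulVec_mulVec,
      Matrix.nonsing_inv_mul _ (isUnit_iff_ne_zero.2 hA), Matrix.one_mulVec]
  · rw [hw l hl, principalSolve_of_notMem hl]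

theorem principalSolve_zero {A : Matrix ι ι ℝ} {γ : Finset ι} (hA : PrincipalRegular A γ) :
    principalSolve A γ 0 = 0 :=
  (eq_principalSolve hA (fun _ _ => rfl) (by simp)).symm

theorem principalRegular_of_injective {A : Matrix ι ι ℝ} {γ : Finset ι}
    (h : ∀ w : ι → ℝ, (∀ l, l ∉ γ → w l = 0) → (∀ i ∈ γ, ∑ l, A i l * w l = 0) → w = 0) :
    PrincipalRegular A γ := by
  intro h0
  obtain ⟨v, hv, hAv⟩ := Matrix.exists_mulVec_eq_zero_iff.2 h0
  refine hv ?_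
  have h1 := h (fun l => if hl : l ∈ γ then v ⟨l, hl⟩ else 0) (fun l hl => dif_neg hl) ?_
  · funext l
    simpa using congrFun h1 l
  · intro i hi
    rw [sum_eq_sum_coe (γ := γ) fun l hl => by rw [dif_neg hl, mul_zero]]
    have := congrFun hAv ⟨i, hi⟩
    simpa [Matrix.mulVec, dotProduct] using this

/-- The residual `b - A w` of the principal solution `w`; for the columns `b` of `A` this is the
Schur complement. -/
noncomputable def residual (A : Matrix ι ι ℝ) (γ : Finset ι) (b : ι → ℝ) (i : ι) : ℝ :=
  b i - ∑ l, A i l * principalSolve A γ b l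

/-- The Schur complement of the principal block of `A` on `γ`, with zero rows and columns at the
indices in `γ`. -/
noncomputable def schur (A : Matrix ι ι ℝ) (γ : Finset ι) : Matrix ι ι ℝ :=
  fun i j => residual A γ (fun l => A l j) i

theorem residual_of_mem {A : Matrix ι ι ℝ} {γ : Finset ι} (hA : PrincipalRegular A γ)
    (b : ι → ℝ) {i : ι} (hi : i ∈ γ) : residual A γ b i = 0 := by
  rw [residual, sum_mul_principalSolve hA b hi, sub_self]

theorem schur_of_mem_left {A : Matrix ι ι ℝ} {γ : Finset ι} (hA : PrincipalRegular A γ)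
    {i : ι} (hi : i ∈ γ) (j : ι) : schur A γ i j = 0 :=
  residual_of_mem hA _ hi

/-- Back substitution: from a vector `u` for the Schur complement system with right hand side
`residual A γ b` to a vector for the system `A w = b`. -/
noncomputable def backSubst (A : Matrix ι ι ℝ) (γ : Finset ι) (b u : ι → ℝ) (l : ι) : ℝ :=
  principalSolve A γ b l + u l - ∑ m, u m * principalSolve A γ (fun p => A p m) l

theorem backSubst_of_notMem (A : Matrix ι ι ℝ) {γ : Finset ι} (b u : ι → ℝ) {l : ι}
    (hl : l ∉ γ) : backSubst A γ b u l = u l := by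
  simp [backSubst, principalSolve_of_notMem hl]

theorem sub_sum_backSubst (A : Matrix ι ι ℝ) (γ : Finset ι) (b u : ι → ℝ) (i : ι) :
    b i - ∑ l, A i l * backSubst A γ b u l =
      residual A γ b i - ∑ l, schur A γ i l * u l := by
  have h : ∑ l, A i l * ∑ m, u m * principalSolve A γ (fun p => A p m) l =
      ∑ m, (∑ l, A i l * principalSolve A γ (fun p => A p m) l) * u m := by
    simp_rw [Finset.mul_sum, Finset.sum_mul]
    rw [Finset.sum_comm]
    exact Finset.sum_congr rfl fun m _ => Finset.sum_congr rfl fun l _ => by ring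
  simp only [backSubst, schur, residual, mul_add, mul_sub, sub_mul, Finset.sum_add_distrib,
    Finset.sum_sub_distrib, h]
  ring

/-- The row form `(a A_γ⁻¹) b = a (A_γ⁻¹ b)` of the solution. -/
theorem sum_mul_principalSolve_eq_transpose {A : Matrix ι ι ℝ} {γ : Finset ι}
    (hA : PrincipalRegular A γ) (a b : ι → ℝ) :
    ∑ j, principalSolve Aᵀ γ a j * b j = ∑ j, a j * principalSolve A γ b j := by
  set c := principalSolve Aᵀ γ a with hc
  set s := principalSolve A γ b with hs
  have h1 : ∑ l, c l * ∑ m, A l m * s m = ∑ l, c l * b l := by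
    refine Finset.sum_congr rfl fun l _ => ?_
    by_cases hl : l ∈ γ
    · rw [hs, sum_mul_principalSolve hA _ hl]
    · rw [hc, principalSolve_of_notMem hl, zero_mul, zero_mul]
  have h2 : ∑ m, (∑ l, Aᵀ m l * c l) * s m = ∑ m, a m * s m := by
    refine Finset.sum_congr rfl fun l _ => ?_
    by_cases hl : l ∈ γ
    · rw [hc, sum_mul_principalSolve hA.transpose _ hl]
    · rw [hs, principalSolve_of_notMem hl, mul_zero, mul_zero]
  rw [← h1, ← h2]
  simp_rw [Finset.mul_sum, Finset.sum_mul]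
  rw [Finset.sum_comm]
  exact Finset.sum_congr rfl fun m _ => Finset.sum_congr rfl fun l _ => by
    rw [Matrix.transpose_apply]; ring

/-- A principal block of the Schur complement is regular if the larger block of `A` is. -/
theorem principalRegular_schur {A : Matrix ι ι ℝ} {γ β : Finset ι} (hA : PrincipalRegular A γ)
    (hAβ : PrincipalRegular A (γ ∪ β)) (hd : Disjoint γ β) :
    PrincipalRegular (schur A γ) β := by
  refine principalRegular_of_injective fun u hu h => ?_
  have h0 : ∀ i, residual A γ 0 i = 0 := fun i => by simp [residual, principalSolve_zero hA]
  have hw : backSubst A γ 0 u = principalSolve A (γ ∪ β) 0 := by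
    refine eq_principalSolve hAβ (fun l hl => ?_) fun i hi => ?_
    · rw [Finset.mem_union, not_or] at hl
      rw [backSubst_of_notMem A 0 u hl.1, hu l hl.2]
    · have h1 := sub_sum_backSubst A γ 0 u i
      rw [h0] at h1
      have h2 : ∑ l, schur A γ i l * u l = 0 := by
        rcases Finset.mem_union.1 hi with hi | hi
        · simp [schur_of_mem_left hA hi]
        · exact h i hi
      rw [h2, sub_zero, sub_eq_zero] at h1
      exact h1.symm
  rw [principalSolve_zero hAβ] at hw
  funext l
  by_cases hl : l ∈ γ
  · exact hu l (Finset.disjoint_left.1 hd hl)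
  · rw [← backSubst_of_notMem A 0 u hl, hw]

theorem sum_mul_single_add_single {E : Type*} [AddCommGroup E] [Module ℝ E] (a : ι → E) (i j : ι)
    (p q : ℝ) : ∑ l, (Pi.single i p + Pi.single j q : ι → ℝ) l • a l = p • a i + q • a j := by
  simp [add_smul, Finset.sum_add_distrib, Pi.single_apply, ite_smul]

theorem principalSolve_pair {A : Matrix ι ι ℝ} {i j : ι} (hij : i ≠ j)
    (hA : PrincipalRegular A {i, j}) (b : ι → ℝ) :
    principalSolve A {i, j} b = Pi.single i (((pairBlock A i j)⁻¹ *ᵥ ![b i, b j]) 0) +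
      Pi.single j (((pairBlock A i j)⁻¹ *ᵥ ![b i, b j]) 1) := by
  set y := (pairBlock A i j)⁻¹ *ᵥ ![b i, b j] with hy
  have h : pairBlock A i j *ᵥ y = ![b i, b j] := by
    rw [hy, Matrix.mulVec_mulVec, Matrix.mul_nonsing_inv _
      (isUnit_iff_ne_zero.2 ((det_pairBlock_ne_zero hij).2 hA)), Matrix.one_mulVec]
  have hs : ∀ p, ∑ l, A p l * (Pi.single i (y 0) + Pi.single j (y 1) : ι → ℝ) l =
      A p i * y 0 + A p j * y 1 := fun p => by
    have := sum_mul_single_add_single (fun l => A p l) i j (y 0) (y 1)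
    simp only [smul_eq_mul] at this
    rw [mul_comm (A p i), mul_comm (A p j), ← this]
    exact Finset.sum_congr rfl fun l _ => mul_comm _ _
  refine (eq_principalSolve hA (fun l hl => ?_) fun p hp => ?_).symm
  · simp only [Finset.mem_insert, Finset.mem_singleton, not_or] at hl
    simp [hl.1, hl.2]
  · rw [hs]
    rcases Finset.mem_insert.1 hp with rfl | hp
    · simpa [Matrix.mulVec, dotProduct, Fin.sum_univ_two, pairBlock] using congrFun h 0
    · rw [Finset.mem_singleton] at hp
      subst hp
      simpa [Matrix.mulVec, dotProduct, Fin.sum_univ_two, pairBlock] using congrFun h 1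

variable {W : Type*} [NormedAddCommGroup W] [InnerProductSpace ℝ W]

/-- `y - ∑ l, w l • F l`, where `w` is the principal solution for the right hand side `b`. -/
noncomputable def reduce (A : Matrix ι ι ℝ) (γ : Finset ι) (F : ι → W) (b : ι → ℝ) (y : W) : W :=
  y - ∑ l, principalSolve A γ b l • F l

theorem reduce_sub_sum (A : Matrix ι ι ℝ) (γ : Finset ι) (F : ι → W) (b u : ι → ℝ) (y : W) :
    reduce A γ F b y - ∑ m, u m • reduce A γ F (fun p => A p m) (F m) =
      y - ∑ l, backSubst A γ b u l • F l := by
  have h : ∑ l, (∑ m, u m * principalSolve A γ (fun p => A p m) l) • F l =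
      ∑ m, u m • ∑ l, principalSolve A γ (fun p => A p m) l • F l := by
    simp_rw [Finset.sum_smul, Finset.smul_sum, smul_smul]
    exact Finset.sum_comm
  simp only [reduce, backSubst, add_smul, sub_smul, smul_sub, Finset.sum_add_distrib,
    Finset.sum_sub_distrib, h]
  abel

/-- The orthogonal transformation `y ↦ y - F A_γ⁻¹ Fᵗ y`. -/
noncomputable def reflect (A : Matrix ι ι ℝ) (γ : Finset ι) (F : ι → W) (y : W) : W :=
  reduce A γ F (fun i => inner ℝ (F i) y) y

/-- The form `(v, w) ↦ wᵗ (A + Aᵗ) v` on solutions of principal subsystems. -/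
theorem sum_principalSolve_cross {A : Matrix ι ι ℝ} {γ : Finset ι} (hA : PrincipalRegular A γ)
    (a b : ι → ℝ) :
    ∑ m, principalSolve A γ b m * ∑ l, principalSolve A γ a l * (A l m + A m l) =
      ∑ l, principalSolve A γ a l * b l + ∑ m, principalSolve A γ b m * a m := by
  set c := principalSolve A γ a with hc
  set s := principalSolve A γ b with hs
  have h1 : ∑ l, c l * ∑ m, A l m * s m = ∑ l, c l * b l := by
    refine Finset.sum_congr rfl fun l _ => ?_
    by_cases hl : l ∈ γ
    · rw [hs, sum_mul_principalSolve hA _ hl]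
    · rw [hc, principalSolve_of_notMem hl, zero_mul, zero_mul]
  have h2 : ∑ m, s m * ∑ l, A m l * c l = ∑ m, s m * a m := by
    refine Finset.sum_congr rfl fun l _ => ?_
    by_cases hl : l ∈ γ
    · rw [hc, sum_mul_principalSolve hA _ hl]
    · rw [hs, principalSolve_of_notMem hl, zero_mul, zero_mul]
  rw [← h1, ← h2]
  simp_rw [Finset.mul_sum, mul_add, Finset.sum_add_distrib]
  rw [Finset.sum_comm (f := fun m l => s m * (c l * A l m))]
  congr 1 <;> exact Finset.sum_congr rfl fun m _ => Finset.sum_congr rfl fun l _ => by ring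

/-- If `A + Aᵗ` is the Gram matrix of `F`, the inner products of reduced vectors with reflected ones
are residuals. -/
theorem inner_reduce_reflect {A : Matrix ι ι ℝ} {γ : Finset ι} (hA : PrincipalRegular A γ)
    {F : ι → W} (hF : ∀ i j, A i j + A j i = inner ℝ (F i) (F j)) (i : ι) (y : W) :
    inner ℝ (reduce A γ F (fun p => A p i) (F i)) (reflect A γ F y) =
      residual A γ (fun l => inner ℝ (F l) y) i := by
  set c := principalSolve A γ (fun p => A p i) with hc
  set s := principalSolve A γ (fun l => (inner ℝ (F l) y : ℝ)) with hs
  have h3 := sum_principalSolve_cross hA (fun p => A p i) fun l => (inner ℝ (F l) y : ℝ)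
  rw [← hc, ← hs] at h3
  rw [reflect, reduce, reduce, residual, ← hc, ← hs]
  simp only [inner_sub_left, inner_sub_right, sum_inner, inner_sum, inner_smul_left,
    inner_smul_right, conj_trivial, ← hF]
  simp only [mul_sub, Finset.sum_sub_distrib, h3]
  simp only [mul_add, Finset.sum_add_distrib]
  have h4 : ∑ m, s m * A i m = ∑ m, A i m * s m := Finset.sum_congr rfl fun m _ => mul_comm _ _
  rw [h4]
  ring

theorem inner_reduce_reduce {A : Matrix ι ι ℝ} {γ : Finset ι} (hA : PrincipalRegular A γ)
    {F : ι → W} (hF : ∀ i j, A i j + A j i = inner ℝ (F i) (F j)) (i j : ι) :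
    schur A γ i j + schur A γ j i =
      inner ℝ (reduce A γ F (fun p => A p i) (F i)) (reduce A γ F (fun p => A p j) (F j)) := by
  set c := principalSolve A γ (fun p => A p i) with hc
  set s := principalSolve A γ (fun p => A p j) with hs
  have h3 := sum_principalSolve_cross hA (fun p => A p i) fun p => A p j
  rw [← hc, ← hs] at h3
  rw [reduce, reduce, schur, schur, residual, residual, ← hc, ← hs]
  simp only [inner_sub_left, inner_sub_right, sum_inner, inner_sum, inner_smul_left,
    inner_smul_right, conj_trivial, ← hF]
  simp only [mul_sub, Finset.sum_sub_distrib, h3]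
  simp only [mul_add, Finset.sum_add_distrib]
  have h4 : ∑ m, s m * A i m = ∑ m, A i m * s m := Finset.sum_congr rfl fun m _ => mul_comm _ _
  have h5 : ∑ m, c m * A j m = ∑ m, A j m * c m := Finset.sum_congr rfl fun m _ => mul_comm _ _
  rw [h4, h5]
  ring

end PrincipalSystems

section SmoothSystems

variable {n : ℕ} {M : Type*} [TopologicalSpace M] [ChartedSpace (Eucl n) M]
  {ι : Type*} [DecidableEq ι]

theorem smooth_det [Fintype ι] {A : M → Matrix ι ι ℝ}
    (hA : ∀ i j, ContMDiff (𝓡 n) 𝓘(ℝ, ℝ) ∞ fun x => A x i j) :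
    ContMDiff (𝓡 n) 𝓘(ℝ, ℝ) ∞ fun x => (A x).det := by
  simp_rw [Matrix.det_apply']
  exact smooth_sum _ fun σ _ => (smooth_const_smul _ (contMDiff_finsetProd fun i _ => hA _ _))

theorem smooth_mulVec_inv [Fintype ι] {A : M → Matrix ι ι ℝ} {b : M → ι → ℝ}
    (hA : ∀ i j, ContMDiff (𝓡 n) 𝓘(ℝ, ℝ) ∞ fun x => A x i j) (h0 : ∀ x, (A x).det ≠ 0)
    (hb : ∀ i, ContMDiff (𝓡 n) 𝓘(ℝ, ℝ) ∞ fun x => b x i) (i : ι) :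
    ContMDiff (𝓡 n) 𝓘(ℝ, ℝ) ∞ fun x => ((A x)⁻¹ *ᵥ b x) i := by
  simp only [Matrix.mulVec, dotProduct, Matrix.inv_def, Ring.inverse_eq_inv', Matrix.smul_apply,
    smul_eq_mul, Matrix.adjugate_apply]
  refine smooth_sum _ fun j _ => ContMDiff.mul (ContMDiff.mul (smooth_inv (smooth_det hA) h0)
    (smooth_det fun p q => ?_)) (hb j)
  by_cases hp : p = j
  · subst hp
    simpa using contMDiff_const
  · simpa [Matrix.updateRow_ne hp] using hA p q

theorem smooth_principalSolve {A : M → Matrix ι ι ℝ} {γ : Finset ι} {b : M → ι → ℝ}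
    (hA : ∀ i j, ContMDiff (𝓡 n) 𝓘(ℝ, ℝ) ∞ fun x => A x i j)
    (h0 : ∀ x, PrincipalRegular (A x) γ)
    (hb : ∀ i, ContMDiff (𝓡 n) 𝓘(ℝ, ℝ) ∞ fun x => b x i) (l : ι) :
    ContMDiff (𝓡 n) 𝓘(ℝ, ℝ) ∞ fun x => principalSolve (A x) γ (b x) l := by
  by_cases hl : l ∈ γ
  · simp only [principalSolve, dif_pos hl]
    exact smooth_mulVec_inv (A := fun x => (A x).submatrix (Subtype.val : γ → ι) Subtype.val)
      (fun i j => hA i j) h0 (fun j => hb j) _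
  · simp only [principalSolve, dif_neg hl]
    exact contMDiff_const

end SmoothSystems

/-! ### The transformed data at a vertex -/

section VectorialTransforms

variable {n N k : ℕ} {M : Type*} [TopologicalSpace M] [ChartedSpace (Eucl n) M]
  {f : M → Eucl N} {d : Fin k → Datum n f} {Ω : M → Matrix (Fin k) (Fin k) ℝ}
  {γ : Finset (Fin k)}

/-- The vectorial Ribaucour transform of `f` determined by the data in `γ`: the vertex `γ` of
the cube. -/
noncomputable def vertex (d : Fin k → Datum n f) (Ω : M → Matrix (Fin k) (Fin k) ℝ)
    (γ : Finset (Fin k)) (x : M) : Eucl N :=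
  reduce (Ω x) γ (fun i => (d i).F x) (fun i => (d i).φ x) (f x)

theorem vectorialMap_eq_vertex (d : Fin k → Datum n f) (Ω : M → Matrix (Fin k) (Fin k) ℝ)
    (γ : Finset (Fin k)) : vectorialMap (subData d γ) (subOmega Ω γ) = vertex d Ω γ := by
  funext x
  rw [vectorialMap, vertex, reduce, sum_eq_sum_coe (γ := γ) fun l hl => by
    rw [principalSolve_of_notMem hl, zero_smul]]
  congr 1
  refine Finset.sum_congr rfl fun l _ => ?_
  simp [principalSolve, subData, subOmega]

/-- The function `φ_i - Ω_{iγ} Ω_γ⁻¹ φ_γ` of the transformed datum at the vertex `γ`. -/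
noncomputable def vertexφ (d : Fin k → Datum n f) (Ω : M → Matrix (Fin k) (Fin k) ℝ)
    (γ : Finset (Fin k)) (i : Fin k) (x : M) : ℝ :=
  residual (Ω x) γ (fun l => (d l).φ x) i

/-- The vector field `F_i - F_γ Ω_γ⁻¹ Ω_{γi}` of the transformed datum at the vertex `γ`. -/
noncomputable def vertexF (d : Fin k → Datum n f) (Ω : M → Matrix (Fin k) (Fin k) ℝ)
    (γ : Finset (Fin k)) (i : Fin k) (x : M) : Eucl N :=
  reduce (Ω x) γ (fun l => (d l).F x) (fun l => Ω x l i) ((d i).F x)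

/-- A vector field `H` with `dH = f_* B`, and a column of functions `b` with
`d b_i = ⟨F_i, dH⟩`. The pairs `(f, φ)` and `(F_j, Ω_{·j})` are of this type, which allows to
treat the transformation of `f` and that of the `F_j` at the same time. -/
structure IsColumn (d : Fin k → Datum n f) (H : M → Eucl N) (b : M → Fin k → ℝ)
    (B : ∀ x : M, TangentSpace (𝓡 n) x →L[ℝ] TangentSpace (𝓡 n) x) : Prop where
  smooth_H : ContMDiff (𝓡 n) 𝓘(ℝ, Eucl N) ∞ H
  smooth_b : ∀ i, ContMDiff (𝓡 n) 𝓘(ℝ, ℝ) ∞ fun x => b x i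
  diff_b : ∀ i x X, diff n (fun y => b y i) x X = inner ℝ ((d i).F x) (diff n H x X)
  diff_H : ∀ x X, diff n H x X = diff n f x (B x X)

theorem isColumn_position (hf : IsSmoothImmersion n f) :
    IsColumn d f (fun x i => (d i).φ x) fun _ => ContinuousLinearMap.id ℝ _ where
  smooth_H := hf.1
  smooth_b i := (d i).smooth_φ
  diff_b i x X := ((d i).inner_F x X).symm
  diff_H _ _ := rfl

theorem isColumn_F (hΩ : IsOmega d Ω) (j : Fin k) :
    IsColumn d (d j).F (fun x i => Ω x i j) (d j).Φ where
  smooth_H := (d j).smooth_F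
  smooth_b i := (hΩ i j).1
  diff_b i := (hΩ i j).2.1
  diff_H := (d j).diff_F

/-- The endomorphism `B - ∑ l, u_l Φ_l`. -/
noncomputable def reducedEnd (d : Fin k → Datum n f) (Ω : M → Matrix (Fin k) (Fin k) ℝ)
    (γ : Finset (Fin k)) (b : M → Fin k → ℝ)
    (B : ∀ x : M, TangentSpace (𝓡 n) x →L[ℝ] TangentSpace (𝓡 n) x) (x : M) :
    TangentSpace (𝓡 n) x →L[ℝ] TangentSpace (𝓡 n) x :=
  B x - ∑ l, principalSolve (Ω x) γ (b x) l • (d l).Φ x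

theorem reducedEnd_apply (d : Fin k → Datum n f) (Ω : M → Matrix (Fin k) (Fin k) ℝ)
    (γ : Finset (Fin k)) (b : M → Fin k → ℝ)
    (B : ∀ x : M, TangentSpace (𝓡 n) x →L[ℝ] TangentSpace (𝓡 n) x) (x : M)
    (X : TangentSpace (𝓡 n) x) :
    reducedEnd d Ω γ b B x X = B x X - ∑ l, principalSolve (Ω x) γ (b x) l • (d l).Φ x X := by
  simp [reducedEnd]

section Column

variable {H : M → Eucl N} {b : M → Fin k → ℝ}
  {B : ∀ x : M, TangentSpace (𝓡 n) x →L[ℝ] TangentSpace (𝓡 n) x}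

theorem IsColumn.smooth_solve (hb : IsColumn d H b B) (hΩ : IsOmega d Ω)
    (hγ : ∀ x, PrincipalRegular (Ω x) γ) (l : Fin k) :
    ContMDiff (𝓡 n) 𝓘(ℝ, ℝ) ∞ fun x => principalSolve (Ω x) γ (b x) l :=
  smooth_principalSolve (fun i j => (hΩ i j).1) hγ hb.smooth_b l

theorem IsColumn.diff_reducedEnd (hb : IsColumn d H b B) (x : M) (X : TangentSpace (𝓡 n) x) :
    diff n f x (reducedEnd d Ω γ b B x X) =
      diff n H x X - ∑ l, principalSolve (Ω x) γ (b x) l • diff n (d l).F x X := by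
  simp only [reducedEnd_apply, map_sub, map_sum, map_smul, ← Datum.diff_F, ← hb.diff_H]

/-- The product rule for the residual `b_i - ∑ l, Ω_{il} u_l`, where the terms without `du` are
collected. -/
theorem IsColumn.diff_sub_sum (hb : IsColumn d H b B) (hΩ : IsOmega d Ω)
    (hγ : ∀ x, PrincipalRegular (Ω x) γ) (i : Fin k) (x : M) (X : TangentSpace (𝓡 n) x) :
    diff n (fun y => residual (Ω y) γ (b y) i) x X =
      inner ℝ ((d i).F x) (diff n f x (reducedEnd d Ω γ b B x X)) -
        ∑ l, Ω x i l * diff n (fun y => principalSolve (Ω y) γ (b y) l) x X := by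
  have hu := hb.smooth_solve hΩ hγ
  have hs : ∀ l, ContMDiff (𝓡 n) 𝓘(ℝ, ℝ) ∞ fun y => Ω y i l * principalSolve (Ω y) γ (b y) l :=
    fun l => (hΩ i l).1.mul (hu l)
  unfold residual
  rw [diff_sub (hb.smooth_b i) (smooth_sum _ fun l _ => hs l), diff_sum _ fun l _ => hs l,
    hb.diff_reducedEnd, hb.diff_b, inner_sub_right, inner_sum, sub_sub, ← Finset.sum_add_distrib]
  congr 1
  refine Finset.sum_congr rfl fun l _ => ?_
  rw [diff_mul (hΩ i l).1 (hu l), (hΩ i l).2.1, inner_smul_right]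
  ring

/-- Differentiating `Ω_γ u = b_γ` gives a system with the same matrix for `du`. -/
theorem IsColumn.diff_solve (hb : IsColumn d H b B) (hΩ : IsOmega d Ω)
    (hγ : ∀ x, PrincipalRegular (Ω x) γ) (x : M) (X : TangentSpace (𝓡 n) x) :
    (fun l => diff n (fun y => principalSolve (Ω y) γ (b y) l) x X) =
      principalSolve (Ω x) γ
        fun i => inner ℝ ((d i).F x) (diff n f x (reducedEnd d Ω γ b B x X)) := by
  refine eq_principalSolve (hγ x) (fun l hl => ?_) fun i hi => ?_
  · simp only [principalSolve_of_notMem hl]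
    exact diff_const _ _ _
  · have h := hb.diff_sub_sum hΩ hγ i x X
    simp only [fun y => residual_of_mem (hγ y) (b y) hi] at h
    rw [diff_const] at h
    linarith

theorem IsColumn.diff_residual (hb : IsColumn d H b B) (hΩ : IsOmega d Ω)
    (hγ : ∀ x, PrincipalRegular (Ω x) γ) (i : Fin k) (x : M) (X : TangentSpace (𝓡 n) x) :
    diff n (fun y => residual (Ω y) γ (b y) i) x X = residual (Ω x) γ
      (fun i => inner ℝ ((d i).F x) (diff n f x (reducedEnd d Ω γ b B x X))) i := by
  rw [hb.diff_sub_sum hΩ hγ, residual, ← hb.diff_solve hΩ hγ]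

theorem IsColumn.smooth_reduce (hb : IsColumn d H b B) (hΩ : IsOmega d Ω)
    (hγ : ∀ x, PrincipalRegular (Ω x) γ) :
    ContMDiff (𝓡 n) 𝓘(ℝ, Eucl N) ∞
      fun x => reduce (Ω x) γ (fun i => (d i).F x) (b x) (H x) :=
  hb.smooth_H.sub (smooth_sum _ fun l _ => (hb.smooth_solve hΩ hγ l).smul (d l).smooth_F)

theorem IsColumn.smooth_residual (hb : IsColumn d H b B) (hΩ : IsOmega d Ω)
    (hγ : ∀ x, PrincipalRegular (Ω x) γ) (i : Fin k) :
    ContMDiff (𝓡 n) 𝓘(ℝ, ℝ) ∞ fun x => residual (Ω x) γ (b x) i :=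
  (hb.smooth_b i).sub (smooth_sum _ fun l _ => (hΩ i l).1.mul (hb.smooth_solve hΩ hγ l))

/-- The differential of a reduced vector field is the image of a vector tangent to `f` under the
orthogonal transformation `reflect`, which only depends on the vertex `γ`. -/
theorem IsColumn.diff_reduce (hb : IsColumn d H b B) (hΩ : IsOmega d Ω)
    (hγ : ∀ x, PrincipalRegular (Ω x) γ) (x : M) (X : TangentSpace (𝓡 n) x) :
    diff n (fun y => reduce (Ω y) γ (fun i => (d i).F y) (b y) (H y)) x X =
      reflect (Ω x) γ (fun i => (d i).F x) (diff n f x (reducedEnd d Ω γ b B x X)) := by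
  have hu := hb.smooth_solve hΩ hγ
  have hs : ∀ l, ContMDiff (𝓡 n) 𝓘(ℝ, Eucl N) ∞
      fun y => principalSolve (Ω y) γ (b y) l • (d l).F y := fun l => (hu l).smul (d l).smooth_F
  have hd := hb.diff_solve hΩ hγ x X
  rw [reflect, reduce, ← hd]
  simp only [reduce]
  rw [diff_sub hb.smooth_H (smooth_sum _ fun l _ => hs l), diff_sum _ fun l _ => hs l,
    hb.diff_reducedEnd, sub_sub, ← Finset.sum_add_distrib]
  congr 1
  exact Finset.sum_congr rfl fun l _ => diff_smul (hu l) (d l).smooth_F x X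

end Column

theorem smooth_vertexφ (hf : IsSmoothImmersion n f) (hΩ : IsOmega d Ω)
    (hγ : ∀ x, PrincipalRegular (Ω x) γ) (i : Fin k) :
    ContMDiff (𝓡 n) 𝓘(ℝ, ℝ) ∞ (vertexφ d Ω γ i) :=
  (isColumn_position hf).smooth_residual hΩ hγ i

/-- The endomorphism `I - ∑ l, u_l Φ_l`, `u = Ω_γ⁻¹ φ_γ`, through which the differential of the
vertex `γ` factors. -/
noncomputable def vertexEnd (d : Fin k → Datum n f) (Ω : M → Matrix (Fin k) (Fin k) ℝ)
    (γ : Finset (Fin k)) (x : M) : TangentSpace (𝓡 n) x →L[ℝ] TangentSpace (𝓡 n) x :=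
  reducedEnd d Ω γ (fun x i => (d i).φ x) (fun _ => ContinuousLinearMap.id ℝ _) x

/-- `f_*` followed by the orthogonal transformation `reflect` of the vertex `γ`. -/
noncomputable def vertexPush (d : Fin k → Datum n f) (Ω : M → Matrix (Fin k) (Fin k) ℝ)
    (γ : Finset (Fin k)) (x : M) (X : TangentSpace (𝓡 n) x) : Eucl N :=
  reflect (Ω x) γ (fun i => (d i).F x) (diff n f x X)

theorem diff_vertex (hf : IsSmoothImmersion n f) (hΩ : IsOmega d Ω)
    (hγ : ∀ x, PrincipalRegular (Ω x) γ) (x : M) (X : TangentSpace (𝓡 n) x) :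
    diff n (vertex d Ω γ) x X = vertexPush d Ω γ x ((vertexEnd d Ω γ x).toLinearMap X) :=
  (isColumn_position hf).diff_reduce hΩ hγ x X

theorem diff_vertexF (hΩ : IsOmega d Ω) (hγ : ∀ x, PrincipalRegular (Ω x) γ) (i : Fin k) (x : M)
    (X : TangentSpace (𝓡 n) x) :
    diff n (vertexF d Ω γ i) x X =
      vertexPush d Ω γ x (reducedEnd d Ω γ (fun x l => Ω x l i) (d i).Φ x X) :=
  (isColumn_F hΩ i).diff_reduce hΩ hγ x X

theorem vertexEnd_injective (hf : IsSmoothImmersion n f) (hΩ : IsOmega d Ω)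
    (hγ : ∀ x, PrincipalRegular (Ω x) γ) (hv : IsSmoothImmersion n (vertex d Ω γ)) (x : M) :
    Function.Injective (vertexEnd d Ω γ x).toLinearMap :=
  injective_of_factor (hv.2 x) (diff_vertex hf hΩ hγ x)

/-- `S` commutes with every endomorphism that commutes with all the Codazzi tensors of the
data. -/
def InBicommutant (d : Fin k → Datum n f) {x : M}
    (S : TangentSpace (𝓡 n) x →L[ℝ] TangentSpace (𝓡 n) x) : Prop :=
  ∀ T : TangentSpace (𝓡 n) x →L[ℝ] TangentSpace (𝓡 n) x,
    (∀ l X, T ((d l).Φ x X) = (d l).Φ x (T X)) → ∀ X, T (S X) = S (T X)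

theorem inBicommutant_reducedEnd {b : M → Fin k → ℝ}
    {B : ∀ x : M, TangentSpace (𝓡 n) x →L[ℝ] TangentSpace (𝓡 n) x} {x : M}
    (hB : InBicommutant d (B x)) : InBicommutant d (reducedEnd d Ω γ b B x) := by
  intro T hT X
  simp only [reducedEnd_apply, map_sub, map_sum, map_smul, hT, hB T hT]

/-- The transformed data at the vertex `γ`. -/
theorem exists_vertexDatum [IsManifold (𝓡 n) ∞ M] (hf : IsSmoothImmersion n f) (hΩ : IsOmega d Ω)
    (hγ : ∀ x, PrincipalRegular (Ω x) γ) (hv : IsSmoothImmersion n (vertex d Ω γ)) (i : Fin k) :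
    ∃ e : Datum n (vertex d Ω γ), e.φ = vertexφ d Ω γ i ∧ e.F = vertexF d Ω γ i ∧
      ∀ x, InBicommutant d (e.Φ x) := by
  have hD := fun x => diff_vertex hf hΩ hγ x
  have hin : ∀ x X, inner ℝ (vertexF d Ω γ i x) (diff n (vertex d Ω γ) x X) =
      diff n (vertexφ d Ω γ i) x X := fun x X => by
    rw [hD]
    refine (inner_reduce_reflect (hγ x) (fun i j => (hΩ i j).2.2 x) i _).trans ?_
    exact ((isColumn_position hf).diff_residual hΩ hγ i x X).symm
  have hmem : ∀ x X, ∃ Z, diff n (vertexF d Ω γ i) x X = diff n (vertex d Ω γ) x Z :=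
      fun x X => by
    rw [diff_vertexF hΩ hγ]
    exact exists_of_factor (hv.2 x) (hD x) _
  obtain ⟨e, heφ, heF⟩ := exists_datum hv (smooth_vertexφ hf hΩ hγ i)
    ((isColumn_F hΩ i).smooth_reduce hΩ hγ) hin hmem
  refine ⟨e, heφ, heF, fun x T hT X => ?_⟩
  refine apply_comm_of_factor (T := T.toLinearMap) (Ψ := e.Φ x)
    (D := (vertexEnd d Ω γ x).toLinearMap)
    (B := reducedEnd d Ω γ (fun x l => Ω x l i) (d i).Φ x)
    (vertexEnd_injective hf hΩ hγ hv x) (fun Y => ?_) (fun Y => ?_) (fun Y => ?_) X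
  · refine eq_of_factor (hv.2 x) (hD x) ?_
    rw [← e.diff_F, heF]
    exact diff_vertexF hΩ hγ i x Y
  · exact inBicommutant_reducedEnd (fun T _ X => rfl) T hT Y
  · exact inBicommutant_reducedEnd (fun T hT X => hT i X) T hT Y

theorem isOmega_schur (hΩ : IsOmega d Ω) (hγ : ∀ x, PrincipalRegular (Ω x) γ)
    {e : Fin k → Datum n (vertex d Ω γ)} (he : ∀ i, (e i).F = vertexF d Ω γ i) :
    IsOmega e fun x => schur (Ω x) γ := by
  intro i j
  refine ⟨(isColumn_F hΩ j).smooth_residual hΩ hγ i, fun x X => ?_, fun x => ?_⟩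
  · rw [he, he, diff_vertexF hΩ hγ]
    refine ((isColumn_F hΩ j).diff_residual hΩ hγ i x X).trans ?_
    exact (inner_reduce_reflect (hγ x) (fun i j => (hΩ i j).2.2 x) i _).symm
  · rw [he, he]
    exact inner_reduce_reduce (hγ x) (fun i j => (hΩ i j).2.2 x) i j

end VectorialTransforms

/-! ### The transformed functions do not vanish identically -/

section Cube

variable {n N k : ℕ} {M : Type*} [TopologicalSpace M] [ChartedSpace (Eucl n) M]
  {f : M → Eucl N} {d : Fin k → Datum n f} {Ω : M → Matrix (Fin k) (Fin k) ℝ}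

/-- A nonzero linear relation between the functions `φ_i` contradicts that they span. -/
theorem eq_zero_of_relation
    (hspan : Submodule.span ℝ (Set.range fun (x : M) (i : Fin k) => (d i).φ x) = ⊤)
    (a : Fin k → ℝ) (h : ∀ x, ∑ i, a i * (d i).φ x = 0) : a = 0 := by
  let ψ : (Fin k → ℝ) →ₗ[ℝ] ℝ := ∑ i, a i • LinearMap.proj i
  have hψ : ∀ v, ψ v = ∑ i, a i * v i := fun v => by simp [ψ]
  have h0 : ψ = 0 := by
    refine LinearMap.ext_on hspan ?_
    rintro _ ⟨x, rfl⟩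
    rw [hψ, h]; rfl
  funext i
  have := hψ (Pi.single i 1)
  rw [h0] at this
  simpa [Pi.single_apply] using this.symm

/-- The function of a transformed datum does not vanish identically. Otherwise the row
`c = Ω_{iγ} Ω_γ⁻¹` would be constant, and `φ_i = c φ_γ` would be a linear relation. -/
theorem exists_vertexφ_ne_zero [ConnectedSpace M] [IsManifold (𝓡 n) ∞ M]
    (hf : IsSmoothImmersion n f) (hΩ : IsOmega d Ω)
    (hspan : Submodule.span ℝ (Set.range fun (x : M) (i : Fin k) => (d i).φ x) = ⊤)
    {γ : Finset (Fin k)} (hγ : ∀ x, PrincipalRegular (Ω x) γ)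
    (hv : IsSmoothImmersion n (vertex d Ω γ)) {i : Fin k} (hi : i ∉ γ) :
    ∃ x, vertexφ d Ω γ i x ≠ 0 := by
  by_contra! h0
  set c : M → Fin k → ℝ := fun x => principalSolve (Ω x)ᵀ γ fun j => Ω x i j with hc
  have hcs : ∀ l, ContMDiff (𝓡 n) 𝓘(ℝ, ℝ) ∞ fun x => c x l := fun l =>
    smooth_principalSolve (A := fun x => (Ω x)ᵀ) (b := fun x j => Ω x i j)
      (fun p q => (hΩ q p).1) (fun x => (hγ x).transpose) (fun j => (hΩ i j).1) l
  have hc0 : ∀ x l, l ∉ γ → c x l = 0 := fun x l hl => principalSolve_of_notMem hl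
  have hc1 : ∀ x, ∀ j ∈ γ, ∑ l, Ω x l j * c x l = Ω x i j := fun x j hj =>
    sum_mul_principalSolve (hγ x).transpose (fun j => Ω x i j) hj
  -- the tangential part of `F_i` is the same combination of those of the `F_l`
  have htan : ∀ x Z, inner ℝ ((d i).F x) (diff n f x Z) =
      ∑ l, c x l * inner ℝ ((d l).F x) (diff n f x Z) := fun x Z => by
    obtain ⟨X, rfl⟩ := LinearMap.surjective_of_injective
      (vertexEnd_injective hf hΩ hγ hv x) Z
    have h1 := (isColumn_position hf).diff_residual hΩ hγ i x X
    have h2 : (fun y => residual (Ω y) γ (fun l => (d l).φ y) i) = fun _ => 0 := funext h0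
    rw [h2, diff_const, residual,
      ← sum_mul_principalSolve_eq_transpose (hγ x)] at h1
    exact sub_eq_zero.1 h1.symm
  have hdc : ∀ x X, (fun l => diff n (fun y => c y l) x X) = 0 := fun x X => by
    rw [← principalSolve_zero (hγ x).transpose]
    refine eq_principalSolve (hγ x).transpose (fun l hl => ?_) fun j hj => ?_
    · simp only [hc0 _ l hl]; exact diff_const _ _ _
    · have h1 : diff n (fun y => ∑ l, Ω y l j * c y l) x X = diff n (fun y => Ω y i j) x X := by
        simp only [hc1 _ j hj]
      have h2 : ∀ l ∈ Finset.univ, ContMDiff (𝓡 n) 𝓘(ℝ, ℝ) ∞ fun y => Ω y l j * c y l :=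
        fun l _ => (hΩ l j).1.mul (hcs l)
      rw [diff_sum _ h2, (hΩ i j).2.1, (d j).diff_F, htan] at h1
      simp only [diff_mul (hΩ _ j).1 (hcs _), (hΩ _ j).2.1, (d j).diff_F,
        Finset.sum_add_distrib] at h1
      simp only [Matrix.transpose_apply, Pi.zero_apply]
      simp only [mul_comm (c x _)] at h1
      linarith
  obtain ⟨x₀⟩ := (inferInstance : Nonempty M)
  have hcc : ∀ x l, c x l = c x₀ l := fun x l =>
    eq_of_diff_eq_zero (hcs l) (fun y Y => congrFun (hdc y Y) l) x x₀
  have hrel : ∀ x, ∑ l, (Pi.single i 1 - c x₀ : Fin k → ℝ) l * (d l).φ x = 0 := fun x => by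
    have h1 := h0 x
    rw [vertexφ, residual, ← sum_mul_principalSolve_eq_transpose (hγ x)] at h1
    have h2 : ∑ l, c x l * (d l).φ x = ∑ l, c x₀ l * (d l).φ x := by simp only [hcc x]
    simp only [Pi.sub_apply, sub_mul, Finset.sum_sub_distrib, ← h2]
    simpa [Pi.single_apply] using h1
  have := congrFun (eq_zero_of_relation hspan _ hrel) i
  simp [hc0 x₀ i hi] at this

end Cube

/-! ### Generic systems: edges and faces of the cube -/

section GenericSystems

variable {n N k : ℕ} {M : Type*} [TopologicalSpace M] [ChartedSpace (Eucl n) M]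
  {f : M → Eucl N} {d : Fin k → Datum n f} {Ω : M → Matrix (Fin k) (Fin k) ℝ}

/-- Independent data with commuting Codazzi tensors and a matrix function `Ω` for which all the
vectorial Ribaucour transforms determined by principal blocks of `Ω` are defined. -/
structure GenericSystem (d : Fin k → Datum n f) (Ω : M → Matrix (Fin k) (Fin k) ℝ) : Prop where
  imm : IsSmoothImmersion n f
  omega : IsOmega d Ω
  independent : Independent d
  regular : ∀ γ x, PrincipalRegular (Ω x) γ
  vertex_imm : ∀ γ, IsSmoothImmersion n (vertex d Ω γ)
  comm : ∀ i j x X, (d i).Φ x ((d j).Φ x X) = (d j).Φ x ((d i).Φ x X)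

namespace GenericSystem

theorem vertex_eq_of_solution (S : GenericSystem d Ω)
    {α : Finset (Fin k)} {x : M} {w : Fin k → ℝ}
    (hw : ∀ l, l ∉ α → w l = 0) (h : ∀ i ∈ α, ∑ l, Ω x i l * w l = (d i).φ x) :
    vertex d Ω α x = f x - ∑ l, w l • (d l).F x := by
  rw [eq_principalSolve (S.regular α x) hw h]; rfl

theorem coeff_unique (S : GenericSystem d Ω)
    {x : M} {w w' : Fin k → ℝ}
    (h : f x - ∑ l, w l • (d l).F x = f x - ∑ l, w' l • (d l).F x) : w = w' := by
  have h1 : ∑ l, (w - w') l • (d l).F x = 0 := by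
    simp only [Pi.sub_apply, sub_smul, Finset.sum_sub_distrib]
    rw [sub_eq_zero]
    exact sub_right_injective h
  funext l
  exact sub_eq_zero.1 (Fintype.linearIndependent_iff.1 (S.independent.2 x) _ h1 l)

theorem vertexF_ne_zero (S : GenericSystem d Ω)
    {γ : Finset (Fin k)} {i : Fin k} (hi : i ∉ γ) (x : M) :
    vertexF d Ω γ i x ≠ 0 := by
  intro h
  set c := principalSolve (Ω x) γ fun l => Ω x l i with hc
  have h1 : ∑ l, (Pi.single i 1 - c : Fin k → ℝ) l • (d l).F x = 0 := by
    simp only [Pi.sub_apply, sub_smul, Finset.sum_sub_distrib]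
    rw [← h, vertexF, reduce, ← hc]
    simp [Pi.single_apply, ite_smul]
  have h2 := Fintype.linearIndependent_iff.1 (S.independent.2 x) _ h1 i
  simp [hc, principalSolve_of_notMem hi] at h2

theorem vertex_empty (S : GenericSystem d Ω) : vertex d Ω ∅ = f := by
  funext x
  rw [S.vertex_eq_of_solution (w := 0) (fun _ _ => rfl) (by simp)]
  simp

/-- Passing from the vertex `γ` to the vertex `γ ∪ β` by means of the transformed data. -/
theorem vertex_union (S : GenericSystem d Ω)
    {γ β : Finset (Fin k)} {x : M} {u : Fin k → ℝ}
    (hu : ∀ l, l ∉ β → u l = 0)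
    (h : ∀ i ∈ β, ∑ l, schur (Ω x) γ i l * u l = vertexφ d Ω γ i x) :
    vertex d Ω (γ ∪ β) x = vertex d Ω γ x - ∑ l, u l • vertexF d Ω γ l x := by
  have hγ := S.regular γ x
  refine (S.vertex_eq_of_solution (w := backSubst (Ω x) γ (fun l => (d l).φ x) u)
    (fun l hl => ?_) fun i hi => ?_).trans (reduce_sub_sum _ _ _ _ _ _).symm
  · rw [Finset.mem_union, not_or] at hl
    rw [backSubst_of_notMem _ _ _ hl.1, hu l hl.2]
  · have h1 := sub_sum_backSubst (Ω x) γ (fun l => (d l).φ x) u i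
    have h2 : residual (Ω x) γ (fun l => (d l).φ x) i - ∑ l, schur (Ω x) γ i l * u l = 0 := by
      by_cases hiγ : i ∈ γ
      · simp [residual_of_mem hγ _ hiγ, schur_of_mem_left hγ hiγ]
      · rw [h i ((Finset.mem_union.1 hi).resolve_left hiγ), vertexφ, sub_self]
    linarith

theorem inner_vertexF (S : GenericSystem d Ω)
    (γ : Finset (Fin k)) (i j : Fin k) (x : M) :
    schur (Ω x) γ i j + schur (Ω x) γ j i =
      inner ℝ (vertexF d Ω γ i x) (vertexF d Ω γ j x) :=
  inner_reduce_reduce (S.regular γ x) (fun i j => (S.omega i j).2.2 x) i j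

theorem vertex_insert (S : GenericSystem d Ω)
    {γ : Finset (Fin k)} {i : Fin k} (hi : i ∉ γ) (x : M) :
    vertex d Ω (insert i γ) x = vertex d Ω γ x -
      (((1 / 2 : ℝ) * inner ℝ (vertexF d Ω γ i x) (vertexF d Ω γ i x))⁻¹ * vertexφ d Ω γ i x) •
        vertexF d Ω γ i x := by
  have h0 : (inner ℝ (vertexF d Ω γ i x) (vertexF d Ω γ i x) : ℝ) ≠ 0 :=
    inner_self_ne_zero.2 (S.vertexF_ne_zero hi x)
  have h1 := S.inner_vertexF γ i i x
  set a : ℝ := (1 / 2 : ℝ) * inner ℝ (vertexF d Ω γ i x) (vertexF d Ω γ i x) with ha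
  have ha0 : a ≠ 0 := mul_ne_zero (by norm_num) h0
  have h2 : schur (Ω x) γ i i = a := by rw [ha, ← h1]; ring
  have h3 := S.vertex_union (γ := γ) (β := {i}) (x := x)
    (u := Pi.single i (a⁻¹ * vertexφ d Ω γ i x))
    (fun l hl => by simp_all) (fun p hp => by
      rw [Finset.mem_singleton] at hp
      subst hp
      simp [Pi.single_apply, h2, ha0])
  rw [Finset.union_comm, ← Finset.insert_eq] at h3
  rw [h3]
  simp [Pi.single_apply, ite_smul]

theorem exists_principalSolve_ne_zero [IsManifold (𝓡 n) ∞ M] [ConnectedSpace M] (S : GenericSystem d Ω)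
    {α : Finset (Fin k)} {l : Fin k}
    (hl : l ∈ α) : ∃ x, principalSolve (Ω x) α (fun i => (d i).φ x) l ≠ 0 := by
  by_contra! h
  obtain ⟨x, hx⟩ := exists_vertexφ_ne_zero S.imm S.omega S.independent.1 (S.regular (α.erase l))
    (S.vertex_imm _) (Finset.notMem_erase l α)
  refine hx ?_
  have h1 : principalSolve (Ω x) α (fun i => (d i).φ x) =
      principalSolve (Ω x) (α.erase l) fun i => (d i).φ x := by
    refine eq_principalSolve (S.regular _ x) (fun m hm => ?_) fun i hi =>
      sum_mul_principalSolve (S.regular α x) _ (Finset.mem_of_mem_erase hi)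
    by_cases hml : m = l
    · rw [hml, h x]
    · exact principalSolve_of_notMem fun hm' => hm (Finset.mem_erase.2 ⟨hml, hm'⟩)
  rw [vertexφ, residual, ← h1, sum_mul_principalSolve (S.regular α x) _ hl, sub_self]

/-- Every index of `β` occurs in the expansion of the vertex `β`. -/
theorem subset_of_vertex_eq [IsManifold (𝓡 n) ∞ M] [ConnectedSpace M] (S : GenericSystem d Ω)
    {α β : Finset (Fin k)}
    (h : ∀ x, ∃ w : Fin k → ℝ, (∀ l, l ∉ α → w l = 0) ∧
      vertex d Ω β x = f x - ∑ l, w l • (d l).F x) : β ⊆ α := by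
  intro l hl
  by_contra hlα
  obtain ⟨x, hx⟩ := S.exists_principalSolve_ne_zero hl
  obtain ⟨w, hw, he⟩ := h x
  rw [S.coeff_unique (he : f x - _ = _)] at hx
  exact hx (hw l hlα)

theorem vertex_injective [IsManifold (𝓡 n) ∞ M] [ConnectedSpace M] (S : GenericSystem d Ω)
    {α β : Finset (Fin k)} (hc : α.card = β.card)
    (h : vertex d Ω α = vertex d Ω β) : α = β := by
  refine Finset.eq_of_subset_of_card_le (S.subset_of_vertex_eq fun x => ?_) hc.ge
  rw [h]
  exact ⟨_, fun l hl => principalSolve_of_notMem hl, rfl⟩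

theorem exists_data [IsManifold (𝓡 n) ∞ M] (S : GenericSystem d Ω)
    (γ : Finset (Fin k)) : ∃ e : Fin k → Datum n (vertex d Ω γ),
    (∀ i, (e i).φ = vertexφ d Ω γ i) ∧ (∀ i, (e i).F = vertexF d Ω γ i) ∧
      (∀ i x, InBicommutant d ((e i).Φ x)) ∧
      ∀ i, i ∉ γ → (e i).Determines (vertex d Ω (insert i γ)) := by
  choose e he using exists_vertexDatum S.imm S.omega (S.regular γ) (S.vertex_imm γ)
  refine ⟨e, fun i => (he i).1, fun i => (he i).2.1, fun i => (he i).2.2, fun i hi =>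
    ⟨S.vertex_imm _, S.vertex_imm _, fun x => ?_, fun x => ?_⟩⟩
  · rw [(he i).2.1]; exact S.vertexF_ne_zero hi x
  · rw [(he i).2.1, (he i).1]; exact S.vertex_insert hi x

theorem comm_of_inBicommutant (S : GenericSystem d Ω)
    {x : M} {A B : TangentSpace (𝓡 n) x →L[ℝ] TangentSpace (𝓡 n) x}
    (hA : InBicommutant d A) (hB : InBicommutant d B) : A.comp B = B.comp A := by
  refine ContinuousLinearMap.ext fun X => hB A (fun l Y => ?_) X
  exact (hA ((d l).Φ x) (fun m Z => S.comm l m x Z) Y).symm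

/-- The `2 × 2` block of the Schur complement is the matrix of the face at the vertex `γ`. -/
theorem isVectorialTransform_face (S : GenericSystem d Ω)
    {γ : Finset (Fin k)} {i j : Fin k} (hi : i ∉ γ) (hj : j ∉ γ)
    (hij : i ≠ j) {e : Fin k → Datum n (vertex d Ω γ)} (heφ : ∀ i, (e i).φ = vertexφ d Ω γ i)
    (heF : ∀ i, (e i).F = vertexF d Ω γ i) :
    IsVectorialTransform ![e i, e j] (fun x => pairBlock (schur (Ω x) γ) i j)
      (vertex d Ω (γ ∪ {i, j})) := by
  have hdis : Disjoint γ {i, j} := by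
    rw [Finset.disjoint_left]
    intro l hl hl'
    rcases Finset.mem_insert.1 hl' with rfl | hl'
    · exact hi hl
    · rw [Finset.mem_singleton] at hl'
      subst hl'
      exact hj hl
  have hreg : ∀ x, PrincipalRegular (schur (Ω x) γ) {i, j} := fun x =>
    principalRegular_schur (S.regular γ x) (S.regular _ x) hdis
  have hΩ := isOmega_schur S.omega (S.regular γ) heF
  refine ⟨S.vertex_imm _, ?_, fun x => (det_pairBlock_ne_zero hij).2 (hreg x), S.vertex_imm _,
    fun x => ?_⟩
  · intro p q
    fin_cases p <;> fin_cases q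
    · exact hΩ i i
    · exact hΩ i j
    · exact hΩ j i
    · exact hΩ j j
  · have h := S.vertex_union (γ := γ) (β := {i, j}) (x := x)
      (u := principalSolve (schur (Ω x) γ) {i, j} fun l => vertexφ d Ω γ l x)
      (fun l hl => principalSolve_of_notMem hl)
      (fun l hl => sum_mul_principalSolve (hreg x) _ hl)
    rw [h, vectorialMap]
    congr 1
    rw [principalSolve_pair hij (hreg x), sum_mul_single_add_single, Fin.sum_univ_two]
    have hv : (fun p => ((![e i, e j] : Fin 2 → Datum n (vertex d Ω γ)) p).φ x) =
        ![vertexφ d Ω γ i x, vertexφ d Ω γ j x] := by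
      funext p
      fin_cases p
      · exact congrFun (heφ i) x
      · exact congrFun (heφ j) x
    rw [hv, ← heF, ← heF]
    rfl

/-- The faces of the cube. The data at the vertices `γ ∪ {i}`, `γ ∪ {j}` and `γ ∪ {i, j}` that point
back to the lower vertices are inverses of transformed data. -/
theorem isBianchiQuadrilateral [IsManifold (𝓡 n) ∞ M] (S : GenericSystem d Ω)
    {γ : Finset (Fin k)} {i j : Fin k} (hi : i ∉ γ) (hj : j ∉ γ)
    (hij : i ≠ j) :
    IsBianchiQuadrilateral n (vertex d Ω γ) (vertex d Ω (insert i γ)) (vertex d Ω (insert j γ))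
      (vertex d Ω (insert j (insert i γ))) := by
  obtain ⟨a, haφ, haF, haΦ, haD⟩ := S.exists_data γ
  obtain ⟨bi, -, -, hbiΦ, hbiD⟩ := S.exists_data (insert i γ)
  obtain ⟨bj, -, -, hbjΦ, hbjD⟩ := S.exists_data (insert j γ)
  have hj' : j ∉ insert i γ := by simp [hj, hij.symm]
  have hi' : i ∉ insert j γ := by simp [hi, hij]
  have h1 := hbiD j hj'
  have h2 := hbjD i hi'
  rw [Finset.insert_comm] at h2
  obtain ⟨b, hb, hbΦ⟩ := Datum.exists_inverse (haD i hi)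
  obtain ⟨c, hc, hcΦ⟩ := Datum.exists_inverse (haD j hj)
  obtain ⟨e₁, he₁, he₁Φ⟩ := Datum.exists_inverse h1
  obtain ⟨e₂, he₂, he₂Φ⟩ := Datum.exists_inverse h2
  refine ⟨a i, a j, b, bi j, c, bj i, e₁, e₂, haD i hi, haD j hj, hb, h1, hc, h2, he₁, he₂,
    fun x => S.comm_of_inBicommutant (haΦ i x) (haΦ j x),
    fun x => S.comm_of_inBicommutant (fun T hT => hbΦ x T (haΦ i x T hT)) (hbiΦ j x),
    fun x => S.comm_of_inBicommutant (fun T hT => hcΦ x T (haΦ j x T hT)) (hbjΦ i x),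
    fun x => S.comm_of_inBicommutant (fun T hT => he₁Φ x T (hbiΦ j x T hT))
      (fun T hT => he₂Φ x T (hbjΦ i x T hT)), fun x => pairBlock (schur (Ω x) γ) i j, ?_⟩
  have h := S.isVectorialTransform_face hi hj hij haφ haF
  have hset : γ ∪ {i, j} = insert j (insert i γ) := by
    ext l; simp; tauto
  rwa [hset] at h

end GenericSystem

end GenericSystems

/-! ### Uniqueness of the labelling -/

section Quadrilaterals

variable {n N : ℕ} {M : Type*} [TopologicalSpace M] [ChartedSpace (Eucl n) M]
  {f f₁ f₂ h : M → Eucl N}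

/-- A vectorial Ribaucour transform does not change when the data are rescaled by constants. -/
theorem IsVectorialTransform.rescale {ι : Type*} [Fintype ι] [DecidableEq ι] {d e : ι → Datum n f}
    {s : ι → ℝ} (hs : ∀ p, s p ≠ 0) (hφ : ∀ p x, (e p).φ x = s p * (d p).φ x)
    (hF : ∀ p x, (e p).F x = s p • (d p).F x) {Ω : M → Matrix ι ι ℝ}
    (H : IsVectorialTransform e Ω h) : IsVectorialTransform d
      (fun x => Matrix.diagonal s⁻¹ * Ω x * Matrix.diagonal s⁻¹) h := by
  obtain ⟨hf, hΩ, hdet, hh, hmap⟩ := H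
  have hentry : ∀ x p q, (Matrix.diagonal s⁻¹ * Ω x * Matrix.diagonal s⁻¹) p q =
      ((s p)⁻¹ * (s q)⁻¹) * Ω x p q := fun x p q => by
    rw [Matrix.mul_diagonal, Matrix.diagonal_mul, Pi.inv_apply, Pi.inv_apply]; ring
  have hdF : ∀ p x X, diff n (e p).F x X = s p • diff n (d p).F x X := fun p x X => by
    rw [← diff_const_smul _ (d p).smooth_F, ← funext (hF p)]
  have hdd : (Matrix.diagonal s⁻¹).det ≠ 0 := by
    rw [Matrix.det_diagonal]
    exact Finset.prod_ne_zero_iff.2 fun p _ => inv_ne_zero (hs p)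
  have hdet' : ∀ x, (Matrix.diagonal s⁻¹ * Ω x * Matrix.diagonal s⁻¹).det ≠ 0 := fun x => by
    rw [Matrix.det_mul, Matrix.det_mul]
    exact mul_ne_zero (mul_ne_zero hdd (hdet x)) hdd
  refine ⟨hf, fun p q => ?_, hdet', hh, fun x => ?_⟩
  · simp only [hentry]
    obtain ⟨h1, h2, h3⟩ := hΩ p q
    refine ⟨smooth_const_smul _ h1, fun x X => ?_, fun x => ?_⟩
    · refine (diff_const_smul _ h1 x X).trans ?_
      rw [h2, hF, hdF, inner_smul_left, inner_smul_right, conj_trivial, smul_eq_mul]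
      field_simp [hs p, hs q]
    · have := h3 x
      rw [hF, hF, inner_smul_left, inner_smul_right, conj_trivial] at this
      rw [mul_comm (s q)⁻¹, ← mul_add, this]
      field_simp [hs p, hs q]
  · rw [hmap, vectorialMap, vectorialMap]
    set y := (Ω x)⁻¹ *ᵥ fun j => (e j).φ x with hy
    have hΩy : Ω x *ᵥ y = fun j => (e j).φ x := by
      rw [hy, Matrix.mulVec_mulVec, Matrix.mul_nonsing_inv _ (isUnit_iff_ne_zero.2 (hdet x)),
        Matrix.one_mulVec]
    have hz : (Matrix.diagonal s⁻¹ * Ω x * Matrix.diagonal s⁻¹) *ᵥ (fun p => s p * y p) =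
        fun j => (d j).φ x := by
      have h1 : Matrix.diagonal s⁻¹ *ᵥ (fun p => s p * y p) = y := by
        funext p
        rw [Matrix.mulVec_diagonal, Pi.inv_apply, inv_mul_cancel_left₀ (hs p)]
      rw [← Matrix.mulVec_mulVec, h1, ← Matrix.mulVec_mulVec, hΩy]
      funext p
      rw [Matrix.mulVec_diagonal, Pi.inv_apply, hφ, inv_mul_cancel_left₀ (hs p)]
    rw [← hz, Matrix.mulVec_mulVec, Matrix.nonsing_inv_mul _ (isUnit_iff_ne_zero.2 (hdet' x)),
      Matrix.one_mulVec]
    congr 1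
    refine Finset.sum_congr rfl fun p _ => ?_
    rw [hF, smul_smul, mul_comm]

theorem Datum.Φ_eq_smul (hf : IsSmoothImmersion n f) {d e : Datum n f} {c : ℝ}
    (h : ∀ x, e.F x = c • d.F x) (x : M) (X : TangentSpace (𝓡 n) x) :
    e.Φ x X = c • d.Φ x X := by
  apply hf.2 x
  rw [← e.diff_F, map_smul, ← d.diff_F, ← diff_const_smul _ d.smooth_F, ← funext h]

/-- The data of the edges `f → f₁`, `f → f₂` of a Bianchi quadrilateral may be prescribed, as long
as their functions do not vanish identically. -/
theorem IsBianchiQuadrilateral.exists_isVectorialTransform [IsManifold (𝓡 n) ∞ M]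
    [PreconnectedSpace M] (H : IsBianchiQuadrilateral n f f₁ f₂ h) {d₁ d₂ : Datum n f}
    (h₁ : d₁.Determines f₁) (h₂ : d₂.Determines f₂) (hφ₁ : ∃ x, d₁.φ x ≠ 0)
    (hφ₂ : ∃ x, d₂.φ x ≠ 0) :
    CodazziCommute d₁ d₂ ∧ ∃ Ω : M → Matrix (Fin 2) (Fin 2) ℝ,
      IsVectorialTransform ![d₁, d₂] Ω h := by
  obtain ⟨a₁, a₂, -, -, -, -, -, -, ha₁, ha₂, -, -, -, -, -, -, hcomm, -, -, -, Ω, hΩ⟩ := H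
  obtain ⟨x₁, hx₁⟩ := hφ₁
  obtain ⟨x₂, hx₂⟩ := hφ₂
  obtain ⟨c₁, hc₁, hcφ₁, hcF₁⟩ := Datum.proportional h₁ ha₁ hx₁
  obtain ⟨c₂, hc₂, hcφ₂, hcF₂⟩ := Datum.proportional h₂ ha₂ hx₂
  constructor
  · intro x
    refine ContinuousLinearMap.ext fun X => ?_
    have h1 := congrArg (fun L => L X) (hcomm x)
    simp only [ContinuousLinearMap.comp_apply, Datum.Φ_eq_smul h₁.1 hcF₁,
      Datum.Φ_eq_smul h₁.1 hcF₂, map_smul, smul_smul] at h1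
    rw [mul_comm c₂] at h1
    exact smul_right_injective _ (mul_ne_zero hc₁ hc₂) h1
  · refine ⟨_, hΩ.rescale (s := ![c₁, c₂]) (d := ![d₁, d₂]) ?_ ?_ ?_⟩ <;> intro p <;> fin_cases p
    · exact hc₁
    · exact hc₂
    · exact hcφ₁
    · exact hcφ₂
    · exact hcF₁
    · exact hcF₂

end Quadrilaterals

section Uniqueness

variable {n N k : ℕ} {M : Type*} [TopologicalSpace M] [ChartedSpace (Eucl n) M]
  {f : M → Eucl N} {d : Fin k → Datum n f} {Ω : M → Matrix (Fin k) (Fin k) ℝ}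

namespace GenericSystem

/-- The fourth vertex of a Bianchi quadrilateral on the edges that leave the vertex
`γ = α \ {i, j}` is `f - F w`, where `w` solves the system of the vertex `α` up to an antisymmetric
change `t` of the entries of `Ω` at `(i, j)` and `(j, i)`. -/
theorem exists_of_quadrilateral [IsManifold (𝓡 n) ∞ M] [ConnectedSpace M]
    (S : GenericSystem d Ω) {α : Finset (Fin k)} {i j : Fin k} (hi : i ∈ α) (hj : j ∈ α)
    (hij : i ≠ j) {h : M → Eucl N}
    (H : IsBianchiQuadrilateral n (vertex d Ω ((α.erase i).erase j)) (vertex d Ω (α.erase i))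
      (vertex d Ω (α.erase j)) h) (x : M) :
    ∃ (t : ℝ) (w : Fin k → ℝ), (∀ l, l ∉ α → w l = 0) ∧ h x = f x - ∑ l, w l • (d l).F x ∧
      (∀ p ∈ α, p ≠ i → p ≠ j → ∑ l, Ω x p l * w l = (d p).φ x) ∧
      ∑ l, Ω x i l * w l + t * w j = (d i).φ x ∧ ∑ l, Ω x j l * w l - t * w i = (d j).φ x := by
  set γ := (α.erase i).erase j with hγ
  have hiγ : i ∉ γ := by simp [hγ]
  have hjγ : j ∉ γ := by simp [hγ]
  have h1 : α.erase i = insert j γ :=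
    (Finset.insert_erase (Finset.mem_erase.2 ⟨hij.symm, hj⟩)).symm
  have h2 : α.erase j = insert i γ := by
    rw [hγ, Finset.erase_right_comm]
    exact (Finset.insert_erase (Finset.mem_erase.2 ⟨hij, hi⟩)).symm
  obtain ⟨e, heφ, heF, -, heD⟩ := S.exists_data γ
  have hne : ∀ l, l ∉ γ → ∃ y, (e l).φ y ≠ 0 := fun l hl => by
    rw [heφ]
    exact exists_vertexφ_ne_zero S.imm S.omega S.independent.1 (S.regular γ) (S.vertex_imm γ) hl
  obtain ⟨-, W, -, hW, hdet, -, hmap⟩ := H.exists_isVectorialTransform (h1 ▸ heD j hjγ)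
    (h2 ▸ heD i hiγ) (hne j hjγ) (hne i hiγ)
  have hFi := S.inner_vertexF γ i i x
  have hFj := S.inner_vertexF γ j j x
  have hFij := S.inner_vertexF γ j i x
  have hW0 : W x 0 0 + W x 0 0 = _ := (hW 0 0).2.2 x
  have hW1 : W x 1 1 + W x 1 1 = _ := (hW 1 1).2.2 x
  have hW2 : W x 0 1 + W x 1 0 = _ := (hW 0 1).2.2 x
  simp only [Matrix.cons_val_zero, Matrix.cons_val_one, heF, ← hFi, ← hFj, ← hFij] at hW0 hW1 hW2
  set y := (W x)⁻¹ *ᵥ fun p => ((![e j, e i] : Fin 2 → Datum n (vertex d Ω γ)) p).φ x with hy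
  have hWy : W x *ᵥ y = fun p => ((![e j, e i] : Fin 2 → Datum n (vertex d Ω γ)) p).φ x := by
    rw [hy, Matrix.mulVec_mulVec, Matrix.mul_nonsing_inv _ (isUnit_iff_ne_zero.2 (hdet x)),
      Matrix.one_mulVec]
  have hy0 := congrFun hWy 0
  have hy1 := congrFun hWy 1
  simp only [Matrix.mulVec, dotProduct, Fin.sum_univ_two, Matrix.cons_val_zero,
    Matrix.cons_val_one, heφ] at hy0 hy1
  set u : Fin k → ℝ := Pi.single j (y 0) + Pi.single i (y 1) with hu
  have hsu : ∀ p, ∑ l, schur (Ω x) γ p l * u l =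
      schur (Ω x) γ p j * y 0 + schur (Ω x) γ p i * y 1 := fun p => by
    have := sum_mul_single_add_single (fun l => schur (Ω x) γ p l) j i (y 0) (y 1)
    simp only [smul_eq_mul] at this
    rw [mul_comm (schur _ _ _ j), mul_comm (schur _ _ _ i), ← this]
    exact Finset.sum_congr rfl fun l _ => mul_comm _ _
  have hback := sub_sum_backSubst (Ω x) γ (fun l => (d l).φ x) u
  simp only [hsu] at hback
  have hwi : backSubst (Ω x) γ (fun l => (d l).φ x) u i = y 1 := by
    rw [backSubst_of_notMem _ _ _ hiγ, hu]; simp [hij]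
  have hwj : backSubst (Ω x) γ (fun l => (d l).φ x) u j = y 0 := by
    rw [backSubst_of_notMem _ _ _ hjγ, hu]; simp [hij.symm]
  refine ⟨W x 1 0 - schur (Ω x) γ i j, backSubst (Ω x) γ (fun l => (d l).φ x) u,
    fun l hl => ?_, ?_, fun p hp hpi hpj => ?_, ?_, ?_⟩
  · have hli : l ≠ i := fun h0 => hl (h0 ▸ hi)
    have hlj : l ≠ j := fun h0 => hl (h0 ▸ hj)
    rw [backSubst_of_notMem _ _ _ (by simp [hγ, hl]), hu]
    simp [hli, hlj]
  · rw [hmap, vectorialMap]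
    refine Eq.trans ?_ (reduce_sub_sum _ _ _ _ _ _)
    rw [hu, sum_mul_single_add_single (fun m => reduce (Ω x) γ (fun i => (d i).F x)
      (fun p => Ω x p m) ((d m).F x)), Fin.sum_univ_two, ← hy]
    simp only [Matrix.cons_val_zero, Matrix.cons_val_one, heF]
    rfl
  · have hpγ : p ∈ γ := by simp [hγ, hp, hpi, hpj]
    have := hback p
    rw [residual_of_mem (S.regular γ x) _ hpγ, schur_of_mem_left (S.regular γ x) hpγ,
      schur_of_mem_left (S.regular γ x) hpγ] at this
    linarith
  · have := hback i
    have h3 : residual (Ω x) γ (fun l => (d l).φ x) i = vertexφ d Ω γ i x := rfl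
    rw [hwj]
    rw [h3, ← hy1] at this
    have h4 : W x 1 1 = schur (Ω x) γ i i := by linarith
    rw [h4] at this
    linarith
  · have := hback j
    have h3 : residual (Ω x) γ (fun l => (d l).φ x) j = vertexφ d Ω γ j x := rfl
    rw [hwi]
    rw [h3, ← hy0] at this
    have h4 : W x 0 0 = schur (Ω x) γ j j := by linarith
    have h5 : W x 0 1 = schur (Ω x) γ j i + schur (Ω x) γ i j - W x 1 0 := by linarith
    rw [h4, h5] at this
    linarith

/-- For `|α| ≥ 3`, the vertex `α` is determined by the lower ones: each row of its system occurs
unperturbed in the system of a quadrilateral that avoids the row. -/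
theorem eq_vertex_of_quadrilaterals [IsManifold (𝓡 n) ∞ M] [ConnectedSpace M]
    (S : GenericSystem d Ω) {α : Finset (Fin k)} (hα : 3 ≤ α.card) {h : M → Eucl N}
    (H : ∀ i ∈ α, ∀ j ∈ α, i ≠ j → IsBianchiQuadrilateral n (vertex d Ω ((α.erase i).erase j))
      (vertex d Ω (α.erase i)) (vertex d Ω (α.erase j)) h) : h = vertex d Ω α := by
  obtain ⟨i, hi, j, hj, l, hl, hij, hil, hjl⟩ := Finset.two_lt_card.1 hα
  funext x
  obtain ⟨-, w, hw, hx, hwp, -, -⟩ := S.exists_of_quadrilateral hi hj hij (H i hi j hj hij) x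
  obtain ⟨-, v, -, hvx, hvp, -, -⟩ := S.exists_of_quadrilateral hi hl hil (H i hi l hl hil) x
  obtain ⟨-, u, -, hux, hup, -, -⟩ := S.exists_of_quadrilateral hj hl hjl (H j hj l hl hjl) x
  obtain rfl : v = w := S.coeff_unique (hvx.symm.trans hx)
  obtain rfl : u = v := S.coeff_unique (hux.symm.trans hx)
  rw [hx]
  refine (S.vertex_eq_of_solution hw fun p hp => ?_).symm
  by_cases hpi : p = i
  · subst hpi
    exact hup p hp hij hil
  · by_cases hpj : p = j
    · subst hpj
      exact hvp p hp hpi hjl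
    · exact hwp p hp hpi hpj

/-- For `|α| = 2` the antisymmetric part remains free, but among the vertices of level two the
expansion in the `F_i` singles out the right one. -/
theorem eq_vertex_of_quadrilateral [IsManifold (𝓡 n) ∞ M] [ConnectedSpace M]
    (S : GenericSystem d Ω) {α β : Finset (Fin k)} (hα : α.card = 2) (hβ : β.card = 2)
    (H : ∀ i ∈ α, ∀ j ∈ α, i ≠ j → IsBianchiQuadrilateral n (vertex d Ω ((α.erase i).erase j))
      (vertex d Ω (α.erase i)) (vertex d Ω (α.erase j)) (vertex d Ω β)) : β = α := by
  obtain ⟨i, j, hij, rfl⟩ := Finset.card_eq_two.1 hα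
  refine Finset.eq_of_subset_of_card_le (S.subset_of_vertex_eq fun x => ?_) (by rw [hα, hβ])
  obtain ⟨-, w, hw, hx, -⟩ := S.exists_of_quadrilateral (by simp) (by simp) hij
    (H i (by simp) j (by simp) hij) x
  exact ⟨w, hw, hx⟩

/-- A labelling of a cube that agrees with `vertex` up to level one, and whose second level consists
of vertices of level two, agrees with `vertex` everywhere. -/
theorem labelling_eq [IsManifold (𝓡 n) ∞ M] [ConnectedSpace M]
    (S : GenericSystem d Ω) {C : Fin (k + 1) → Set (M → Eucl N)} {c : Finset (Fin k) → M → Eucl N}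
    (hC : IsCubeLabelling n C c) {σ : Equiv.Perm (Fin k)} (h0 : c ∅ = f)
    (h1 : ∀ i, c {i} = vertex d Ω {σ i})
    (h2 : ∀ α : Finset (Fin k), α.card = 2 → ∃ β : Finset (Fin k), β.card = 2 ∧
      c α = vertex d Ω β) (α : Finset (Fin k)) : c α = vertex d Ω (α.image σ) := by
  induction hm : α.card using Nat.strong_induction_on generalizing α with
  | _ m ih =>
    rcases Nat.lt_or_ge m 2 with hm2 | hm2
    · interval_cases m
      · rw [Finset.card_eq_zero.1 hm, h0, Finset.image_empty, S.vertex_empty]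
      · obtain ⟨i, rfl⟩ := Finset.card_eq_one.1 hm
        rw [h1, Finset.image_singleton]
    · have H : ∀ i ∈ α.image σ, ∀ j ∈ α.image σ, i ≠ j →
          IsBianchiQuadrilateral n (vertex d Ω (((α.image σ).erase i).erase j))
            (vertex d Ω ((α.image σ).erase i)) (vertex d Ω ((α.image σ).erase j)) (c α) := by
        intro p hp q hq hij
        obtain ⟨i, hi, rfl⟩ := Finset.mem_image.1 hp
        obtain ⟨j, hj, rfl⟩ := Finset.mem_image.1 hq
        have hij' : i ≠ j := fun h => hij (by rw [h])
        have hq := hC.face α (hm ▸ hm2) i hi j hj hij'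
        have hci := Finset.card_erase_lt_of_mem hi
        have hcj := Finset.card_erase_lt_of_mem hj
        have hcij : ((α.erase i).erase j).card ≤ (α.erase i).card := Finset.card_erase_le
        rw [ih _ (by omega) (α.erase i) rfl, ih _ (by omega) (α.erase j) rfl,
          ih _ (by omega) ((α.erase i).erase j) rfl] at hq
        simpa only [Finset.image_erase σ.injective] using hq
      have hcard : (α.image σ).card = m := by
        rw [Finset.card_image_of_injective _ σ.injective, hm]
      rcases Nat.lt_or_ge m 3 with hm3 | hm3
      · have hm' : m = 2 := by omega
        obtain ⟨β, hβ, hcβ⟩ := h2 α (by omega)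
        rw [hcβ] at H ⊢
        rw [S.eq_vertex_of_quadrilateral (by omega) hβ H]
      · exact S.eq_vertex_of_quadrilaterals (by omega) H

end GenericSystem

end Uniqueness

/-! ### The matrix function of the quadrilaterals, and the cube -/

section Existence

variable {n N k : ℕ} {M : Type*} [TopologicalSpace M] [ChartedSpace (Eucl n) M]
  {f : M → Eucl N} {d : Fin k → Datum n f}

/-- The matrix function that has the given `2 × 2` matrix functions as principal blocks. Each
block is known up to its off-diagonal entries only, so the block of `i < j` is used for both. -/
noncomputable def assemble (d : Fin k → Datum n f)
    (W : Fin k → Fin k → M → Matrix (Fin 2) (Fin 2) ℝ) (x : M) : Matrix (Fin k) (Fin k) ℝ :=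
  Matrix.of fun i j =>
    if i = j then (1 / 2 : ℝ) * inner ℝ ((d i).F x) ((d i).F x)
    else if i < j then W i j x 0 1 else W j i x 1 0

variable {W : Fin k → Fin k → M → Matrix (Fin 2) (Fin 2) ℝ} {g : Fin k → Fin k → M → Eucl N}

theorem assemble_self (i : Fin k) (x : M) :
    assemble d W x i i = (1 / 2 : ℝ) * inner ℝ ((d i).F x) ((d i).F x) := by
  simp [assemble]

theorem assemble_lt {i j : Fin k} (hij : i < j) (x : M) : assemble d W x i j = W i j x 0 1 := by
  simp [assemble, hij.ne, hij]

theorem assemble_gt {i j : Fin k} (hij : i < j) (x : M) : assemble d W x j i = W i j x 1 0 := by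
  simp [assemble, hij.ne', hij.not_gt]

theorem isOmega_assemble
    (hW : ∀ i j, i < j → IsVectorialTransform ![d i, d j] (W i j) (g i j)) :
    IsOmega d (assemble d W) := by
  intro i j
  rcases lt_trichotomy i j with hij | rfl | hij
  · simp only [assemble_lt hij, assemble_gt hij]
    exact (hW i j hij).2.1 0 1
  · simp only [assemble_self]
    have hs := smooth_inner (d i).smooth_F (d i).smooth_F
    refine ⟨smooth_const_smul _ hs, fun x X => ?_, fun x => by ring⟩
    refine (diff_const_smul _ hs x X).trans ?_
    rw [diff_inner (d i).smooth_F (d i).smooth_F, real_inner_comm ((d i).F x) (diff n _ x X),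
      smul_eq_mul]
    ring
  · simp only [assemble_lt hij, assemble_gt hij]
    exact (hW j i hij).2.1 1 0

theorem pairBlock_assemble
    (hW : ∀ i j, i < j → IsVectorialTransform ![d i, d j] (W i j) (g i j)) {i j : Fin k}
    (hij : i < j) (x : M) : pairBlock (assemble d W x) i j = W i j x := by
  have h0 : W i j x 0 0 + W i j x 0 0 = inner ℝ ((d i).F x) ((d i).F x) :=
    ((hW i j hij).2.1 0 0).2.2 x
  have h1 : W i j x 1 1 + W i j x 1 1 = inner ℝ ((d j).F x) ((d j).F x) :=
    ((hW i j hij).2.1 1 1).2.2 x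
  ext p q
  fin_cases p <;> fin_cases q
  · change assemble d W x i i = W i j x 0 0
    rw [assemble_self]; linarith
  · exact assemble_lt hij x
  · exact assemble_gt hij x
  · change assemble d W x j j = W i j x 1 1
    rw [assemble_self]; linarith

theorem encodes_assemble (hsymm : ∀ i j, g i j = g j i)
    (hW : ∀ i j, i < j → IsVectorialTransform ![d i, d j] (W i j) (g i j)) :
    Encodes d g (assemble d W) := by
  have key : ∀ i j, i < j →
      IsVectorialTransform (subData d {i, j}) (subOmega (assemble d W) {i, j}) (g i j) := by
    intro i j hij
    obtain ⟨hf, -, hdet, hg, hmap⟩ := hW i j hij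
    have hreg : ∀ x, PrincipalRegular (assemble d W x) {i, j} := fun x => by
      rw [← det_pairBlock_ne_zero hij.ne, pairBlock_assemble hW hij]
      exact hdet x
    refine ⟨hf, fun p q => isOmega_assemble hW p q, hreg, hg, fun x => ?_⟩
    rw [vectorialMap_eq_vertex, vertex, reduce, principalSolve_pair hij.ne (hreg x),
      sum_mul_single_add_single, pairBlock_assemble hW hij, hmap, vectorialMap, Fin.sum_univ_two]
    have hv : (fun p => ((![d i, d j] : Fin 2 → Datum n f) p).φ x) =
        ![(d i).φ x, (d j).φ x] := by
      funext p
      fin_cases p <;> rfl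
    rw [hv]
    rfl
  refine ⟨isOmega_assemble hW, fun i j hij => ?_⟩
  rcases lt_or_gt_of_ne hij with h | h
  · exact key i j h
  · rw [hsymm i j, Finset.pair_comm]
    exact key j i h

end Existence

namespace GenericSystem

variable {n N k : ℕ} {M : Type*} [TopologicalSpace M] [ChartedSpace (Eucl n) M]
  {f : M → Eucl N} {d : Fin k → Datum n f} {Ω : M → Matrix (Fin k) (Fin k) ℝ}

theorem vertex_singleton (S : GenericSystem d Ω) {i : Fin k} {g : M → Eucl N} (h : (d i).Determines g) :
    vertex d Ω {i} = g := by
  funext x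
  set a : ℝ := (1 / 2 : ℝ) * inner ℝ ((d i).F x) ((d i).F x) with ha
  have ha0 : a ≠ 0 := mul_ne_zero (by norm_num) (Datum.inner_F_ne_zero h x)
  have h2 : Ω x i i = a := by
    have := (S.omega i i).2.2 x
    rw [ha]; linarith
  rw [S.vertex_eq_of_solution (w := Pi.single i (a⁻¹ * (d i).φ x)) (fun l hl => by simp_all)
    (fun p hp => by
      rw [Finset.mem_singleton] at hp
      subst hp
      simp [Pi.single_apply, h2, ha0]), h.2.2.2 x]
  simp [Pi.single_apply, ite_smul, ha]

theorem isCubeLabelling [IsManifold (𝓡 n) ∞ M] (S : GenericSystem d Ω) : IsCubeLabelling n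
    (fun r : Fin (k + 1) => vertex d Ω '' {α : Finset (Fin k) | α.card = r}) (vertex d Ω) where
  image _ := rfl
  bottom i := by
    obtain ⟨e, -, -, -, he⟩ := S.exists_data ∅
    exact ⟨e i, he i (Finset.notMem_empty i)⟩
  edge α _ i hi := by
    obtain ⟨e, -, -, -, he⟩ := S.exists_data (α.erase i)
    have h := he i (Finset.notMem_erase i α)
    rw [Finset.insert_erase hi] at h
    exact ⟨e i, h⟩
  face α _ i hi j hj hij := by
    have h := S.isBianchiQuadrilateral (γ := (α.erase i).erase j) (i := j) (j := i)
      (by simp) (by simp) hij.symm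
    have h1 : insert j ((α.erase i).erase j) = α.erase i :=
      Finset.insert_erase (Finset.mem_erase.2 ⟨hij.symm, hj⟩)
    have h2 : insert i ((α.erase i).erase j) = α.erase j := by
      rw [Finset.erase_right_comm]
      exact Finset.insert_erase (Finset.mem_erase.2 ⟨hij, hi⟩)
    rwa [h1, h2, Finset.insert_erase hi] at h

/-- Every labelling of a cube with the given lower levels is that by `vertex`, up to a permutation
of the directions. -/
theorem exists_perm [IsManifold (𝓡 n) ∞ M] [ConnectedSpace M] (S : GenericSystem d Ω)
    {fs : Fin k → M → Eucl N} (hfs : ∀ i, vertex d Ω {i} = fs i)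
    {g : Fin k → Fin k → M → Eucl N} (hg : ∀ i j, i ≠ j → vertex d Ω {i, j} = g i j)
    (hk : 2 ≤ k) {C : Fin (k + 1) → Set (M → Eucl N)} (hC0 : ∀ r, r.val = 0 → C r = {f})
    (hC1 : ∀ r, r.val = 1 → C r = Set.range fs)
    (hC2 : ∀ r, r.val = 2 → C r = {h | ∃ i j, i ≠ j ∧ h = g i j})
    {c : Finset (Fin k) → M → Eucl N} (hc : IsCubeLabelling n C c) :
    ∃ σ : Equiv.Perm (Fin k), ∀ α, c α = vertex d Ω (α.image σ) := by
  have hlevel : ∀ (α : Finset (Fin k)) (hα : α.card < k + 1), c α ∈ C ⟨α.card, hα⟩ :=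
    fun α hα => by rw [hc.image]; exact ⟨α, rfl, rfl⟩
  have h0 : c ∅ = f := by
    have := hlevel ∅ (Nat.succ_pos k)
    exact (hC0 ⟨(∅ : Finset (Fin k)).card, Nat.succ_pos k⟩ rfl).subset this
  have h1 : ∀ i, ∃ j, c {i} = vertex d Ω {j} := fun i => by
    have := hlevel {i} (by rw [Finset.card_singleton]; linarith)
    rw [hC1 _ (Finset.card_singleton i)] at this
    obtain ⟨j, hj⟩ := this
    exact ⟨j, by rw [hfs, hj]⟩
  choose τ hτ using h1
  have hsurj : Function.Surjective τ := fun j => by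
    have hk1 : 1 < k + 1 := by linarith
    have : fs j ∈ C ⟨1, hk1⟩ := by rw [hC1 _ rfl]; exact ⟨j, rfl⟩
    rw [hc.image] at this
    obtain ⟨α, hα, hαj⟩ := this
    obtain ⟨i, rfl⟩ := Finset.card_eq_one.1 hα
    refine ⟨i, Finset.singleton_injective (S.vertex_injective (by simp) ?_)⟩
    rw [← hτ, hαj, hfs]
  have h2 : ∀ α : Finset (Fin k), α.card = 2 → ∃ β : Finset (Fin k), β.card = 2 ∧
      c α = vertex d Ω β := fun α hα => by
    have := hlevel α (by rw [hα]; linarith)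
    rw [hC2 _ hα] at this
    obtain ⟨i, j, hij, h⟩ := this
    exact ⟨{i, j}, Finset.card_pair hij, by rw [h, hg i j hij]⟩
  let σ : Equiv.Perm (Fin k) := Equiv.ofBijective τ ⟨Finite.injective_iff_surjective.2 hsurj, hsurj⟩
  exact ⟨σ, S.labelling_eq hc (σ := σ) h0 hτ h2⟩

end GenericSystem

end Ribaucour

theorem theorem2 {n N k : ℕ} (hk : 2 ≤ k) {M : Type*} [TopologicalSpace M] [T2Space M]
    [SecondCountableTopology M] [ConnectedSpace M]
    [ChartedSpace (Eucl n) M] [IsManifold (𝓡 n) ∞ M]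
    (f : M → Eucl N) (hf : Ribaucour.IsSmoothImmersion n f)
    (fs : Fin k → M → Eucl N) (d : Fin k → Ribaucour.Datum n f)
    (hd : ∀ i, (d i).Determines (fs i)) (hind : Ribaucour.Independent d)
    (g : Fin k → Fin k → M → Eucl N) (hsymm : ∀ i j, g i j = g j i)
    (hquad : ∀ i j, i ≠ j → Ribaucour.IsBianchiQuadrilateral n f (fs i) (fs j) (g i j))
    (hgen : Ribaucour.IsGeneric d g) :
    ∃! C : Fin (k + 1) → Set (M → Eucl N), Ribaucour.IsBianchiCube n C ∧
      C ⟨0, by omega⟩ = {f} ∧ C ⟨1, by omega⟩ = Set.range fs ∧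
      C ⟨2, by omega⟩ = {h | ∃ i j, i ≠ j ∧ h = g i j} := by
  open Ribaucour in
  have hφ : ∀ i, ∃ x, (d i).φ x ≠ 0 := fun i => by
    by_contra! h
    have := congrFun (eq_zero_of_relation hind.1 (Pi.single i 1)
      fun x => by simp [Pi.single_apply, h x]) i
    simp at this
  have hq := fun i j hij =>
    (hquad i j hij).exists_isVectorialTransform (hd i) (hd j) (hφ i) (hφ j)
  have hW : ∀ i j, ∃ W : M → Matrix (Fin 2) (Fin 2) ℝ,
      i < j → IsVectorialTransform ![d i, d j] W (g i j) := fun i j => by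
    by_cases hij : i < j
    · obtain ⟨W, h⟩ := (hq i j hij.ne).2
      exact ⟨W, fun _ => h⟩
    · exact ⟨0, fun h => absurd h hij⟩
  choose W hW using hW
  have henc : Encodes d g (assemble d W) := encodes_assemble hsymm hW
  have hgen' := hgen _ henc
  set Ω := assemble d W
  have S : GenericSystem d Ω :=
    { imm := hf
      omega := henc.1
      independent := hind
      regular := fun γ x => (hgen' γ).1 x
      vertex_imm := fun γ => vectorialMap_eq_vertex d Ω γ ▸ (hgen' γ).2
      comm := fun i j x X => by
        by_cases hij : i = j
        · rw [hij]
        · exact congrArg (fun L => L X) ((hq i j hij).1 x) }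
  have hfs : ∀ i, vertex d Ω {i} = fs i := fun i => S.vertex_singleton (hd i)
  have hg : ∀ i j, i ≠ j → vertex d Ω {i, j} = g i j := fun i j hij => by
    rw [← vectorialMap_eq_vertex]
    exact (funext (henc.2 i j hij).2.2.2.2).symm
  have hC0 : vertex d Ω '' {α : Finset (Fin k) | α.card = 0} = {f} := by
    have : {α : Finset (Fin k) | α.card = 0} = {∅} := by ext α; simp
    rw [this, Set.image_singleton, S.vertex_empty]
  have hC1 : vertex d Ω '' {α : Finset (Fin k) | α.card = 1} = Set.range fs := by
    ext h
    constructor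
    · rintro ⟨α, hα, rfl⟩
      obtain ⟨i, rfl⟩ := Finset.card_eq_one.1 hα
      exact ⟨i, (hfs i).symm⟩
    · rintro ⟨i, rfl⟩
      exact ⟨{i}, Finset.card_singleton i, hfs i⟩
  have hC2 : vertex d Ω '' {α : Finset (Fin k) | α.card = 2} =
      {h | ∃ i j, i ≠ j ∧ h = g i j} := by
    ext h
    constructor
    · rintro ⟨α, hα, rfl⟩
      obtain ⟨i, j, hij, rfl⟩ := Finset.card_eq_two.1 hα
      exact ⟨i, j, hij, hg i j hij⟩
    · rintro ⟨i, j, hij, rfl⟩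
      exact ⟨{i, j}, Finset.card_pair hij, hg i j hij⟩
  refine ⟨fun r => vertex d Ω '' {α : Finset (Fin k) | α.card = r}, ⟨⟨fun r => ?_, vertex d Ω,
    S.isCubeLabelling, fun c hc => S.exists_perm hfs hg hk (fun r hr => by rwa [hr])
      (fun r hr => by rwa [hr]) (fun r hr => by rwa [hr]) hc⟩, hC0, hC1, hC2⟩, ?_⟩
  · have hset : {α : Finset (Fin k) | α.card = r} =
        ↑(Finset.powersetCard (r : ℕ) (Finset.univ : Finset (Fin k))) := by
      ext α; simp [Finset.mem_powersetCard]
    have hinj : Set.InjOn (vertex d Ω) {α : Finset (Fin k) | α.card = r} := fun α hα β hβ h =>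
      S.vertex_injective (hα.trans hβ.symm) h
    rw [hinj.ncard_image, hset, Set.ncard_coe_finset, Finset.card_powersetCard, Finset.card_fin]
  · rintro C ⟨⟨-, c, hc, -⟩, h0, h1, h2⟩
    obtain ⟨σ, hσ⟩ := S.exists_perm hfs hg hk (fun r hr => (congrArg C (Fin.ext hr)).trans h0)
      (fun r hr => (congrArg C (Fin.ext hr)).trans h1)
      (fun r hr => (congrArg C (Fin.ext hr)).trans h2) hc
    funext r
    rw [hc.image r]
    ext h
    constructor
    · rintro ⟨α, hα, rfl⟩
      exact ⟨α.image σ, (Finset.card_image_of_injective _ σ.injective).trans hα, (hσ α).symm⟩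
    · rintro ⟨α, hα, rfl⟩
      refine ⟨α.image σ.symm, (Finset.card_image_of_injective _ σ.symm.injective).trans hα, ?_⟩
      rw [hσ, Finset.image_image]
      simp
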